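/- Let $W$ be the standard Wiener random measure on $\mathbb R$ over a probability space $(\Omega,\mathcal F,P)$: an additive random set function on Borel sets of finite Lebesgue measure $\lambda$, with independent values on disjoint sets and $W(A)\sim N(0,\lambda(A))$. For square integrable symmetric $f$ on $\mathbb R^2$ let $\iint f\,dW\,dW$ denote the double It\^o--Wiener integral, that is, the $L^2(P)$-limit of $\sum_{k,j}a_{kj}W(A_k)W(A_j)$ along symmetric simple functions $\sum_{k,j}a_{kj}\mathbf 1_{A_k}(x)\mathbf 1_{A_j}(y)$ (with $A_k$ disjoint of finite measure, $a_{kj}=a_{jk}$, $a_{kk}=0$) converging to $f$ in $L^2(\mathbb R^2)$. Let $T>0$ and let $H_1,H_2:[0,T]\to(1/2,1)$ be continuous functions such that, for some $\gamma>\tfrac12\big(\max_{[0,T]}H_1+\max_{[0,T]}H_2\big)$, $$|H_i(t)-H_i(s)|\le|t-s|^\gamma,\qquad s,t\in[0,T],\ i=1,2.$$ For $h_1,h_2\in(1/2,1)$ put $$K_{h_1,h_2}(s,x,y)=(s-x)_+^{h_1/2-1}(s-y)_+^{h_2/2-1}+(s-x)_+^{h_2/2-1}(s-y)_+^{h_1/2-1},$$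 where $u_+^\alpha=u^\alpha$ for $u>0$ and $u_+^\alpha=0$ for $u\le0$, and let $X=(X_t)_{t\in[0,T]}$ be the multifractional generalized Rosenblatt process $$X_t=\iint_{\mathbb R^2}\Big(\int_0^tK_{H_1(t),H_2(t)}(s,x,y)\,ds\Big)W(dx)\,W(dy)\quad\text{a.s.},\qquad t\in[0,T],$$ taken in any version that is jointly measurable in $(t,\omega)$ up to $\lambda\otimes P$-null sets. Then $X$ has a square integrable local time on $[0,T]$: for every Borel set $A\subseteq[0,T]$ (in particular $A=[0,T]$) there is a nonnegative $L(A,\cdot)\in L^2(\mathbb R\times\Omega,\lambda\otimes P)$ such that, for almost every $\omega$, $$\lambda\big(\{s\in A: X_s(\omega)\in B\}\big)=\int_B L(A,x)(\omega)\,dx\qquad\text{for all Borel }B\subseteq\mathbb R.$$ -/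

import Mathlib

open MeasureTheory ProbabilityTheory Set Filter Topology

noncomputable section

namespace Rosenblatt

/-- `W` is the standard Wiener (white noise) random measure on the real line, under `P`: values on
Borel sets of finite Lebesgue measure are centred Gaussian with variance the Lebesgue measure,
values on disjoint sets are independent, and `W` is (almost surely) additive.  Additivity for two
disjoint sets yields countable additivity in `L²(P)`, by the variances. -/
structure IsWienerMeasure {Ω : Type*} [MeasurableSpace Ω] (P : Measure Ω)
    (W : Set ℝ → Ω → ℝ) : Prop where
  hasLaw : ∀ A : Set ℝ, MeasurableSet A → volume A < ⊤ →
    HasLaw (W A) (gaussianReal 0 (volume A).toNNReal) P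
  indep : ∀ (n : ℕ) (A : Fin n → Set ℝ), (∀ k, MeasurableSet (A k)) → (∀ k, volume (A k) < ⊤) →
    Pairwise (fun j k => Disjoint (A j) (A k)) → iIndepFun (fun k => W (A k)) P
  additive : ∀ A B : Set ℝ, MeasurableSet A → MeasurableSet B → volume A < ⊤ → volume B < ⊤ →
    Disjoint A B → W (A ∪ B) =ᵐ[P] fun ω => W A ω + W B ω

/-- Data of a symmetric simple function on the plane
`f(x,y) = ∑ a k j * 1_{A k}(x) * 1_{A j}(y)` with disjoint sets `A k` of finite measure and a
symmetric coefficient matrix vanishing on the diagonal. -/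
structure SimpleKernel where
  n : ℕ
  A : Fin n → Set ℝ
  a : Fin n → Fin n → ℝ
  measurableSet_A : ∀ k, MeasurableSet (A k)
  volume_A_lt_top : ∀ k, volume (A k) < ⊤
  disjoint_A : Pairwise (fun j k => Disjoint (A j) (A k))
  symm_a : ∀ k j, a k j = a j k
  diag_a : ∀ k, a k k = 0

/-- The function on the plane given by the data. -/
def SimpleKernel.toFun (f : SimpleKernel) (p : ℝ × ℝ) : ℝ :=
  ∑ k, ∑ j, f.a k j * (f.A k).indicator 1 p.1 * (f.A j).indicator 1 p.2

/-- The double Itô–Wiener integral of a simple function. -/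
def SimpleKernel.integral {Ω : Type*} (W : Set ℝ → Ω → ℝ) (f : SimpleKernel) (ω : Ω) : ℝ :=
  ∑ k, ∑ j, f.a k j * W (f.A k) ω * W (f.A j) ω

/-- `ξ` is (a version of) the double Itô–Wiener integral `I₂(f) = ∬ f(x,y) W(dx) W(dy)`: the
`L²(P)`-limit of the integrals of simple functions that converge to `f` in `L²(ℝ²)`. -/
def IsDoubleIntegral {Ω : Type*} [MeasurableSpace Ω] (P : Measure Ω) (W : Set ℝ → Ω → ℝ)
    (f : ℝ × ℝ → ℝ) (ξ : Ω → ℝ) : Prop :=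
  MemLp f 2 (volume : Measure (ℝ × ℝ)) ∧ MemLp ξ 2 P ∧
    ∃ F : ℕ → SimpleKernel,
      Tendsto (fun n => eLpNorm (fun p => (F n).toFun p - f p) 2 (volume : Measure (ℝ × ℝ)))
        atTop (𝓝 0) ∧
      Tendsto (fun n => eLpNorm (fun ω => (F n).integral W ω - ξ ω) 2 P) atTop (𝓝 0)

/-- The truncated power `u₊ ^ α`, equal to `u ^ α` for `u > 0` and to `0` otherwise. -/
def posPow (u α : ℝ) : ℝ := if 0 < u then u ^ α else 0

/-- The kernel `K_{h₁,h₂}(s,x,y)`. -/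
def kernelK (h₁ h₂ s x y : ℝ) : ℝ :=
  posPow (s - x) (h₁ / 2 - 1) * posPow (s - y) (h₂ / 2 - 1) +
    posPow (s - x) (h₂ / 2 - 1) * posPow (s - y) (h₁ / 2 - 1)

/-- The integrated kernel `∫₀ᵗ K_{h₁,h₂}(s,x,y) ds` of the generalized Rosenblatt process at
time `t`.  For `h₁, h₂ ∈ (1/2, 1)` the integrand is integrable for all `x ≠ y`. -/
def rosenblattKernel (h₁ h₂ t : ℝ) (p : ℝ × ℝ) : ℝ :=
  ∫ s in (0 : ℝ)..t, kernelK h₁ h₂ s p.1 p.2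

/-- `X` is the multifractional generalized Rosenblatt process on `[0,T]` with parameter functions
`H₁, H₂`: for each `t`, `X t` is a version of
`∬ (∫₀ᵗ K_{H₁(t),H₂(t)}(s,x,y) ds) W(dx) W(dy)`, and `X` is jointly measurable up to null sets. -/
structure IsMultifractionalRosenblatt {Ω : Type*} [MeasurableSpace Ω] (P : Measure Ω)
    (W : Set ℝ → Ω → ℝ) (T : ℝ) (H₁ H₂ : ℝ → ℝ) (X : ℝ → Ω → ℝ) : Prop where
  isDoubleIntegral : ∀ t ∈ Icc 0 T,
    IsDoubleIntegral P W (rosenblattKernel (H₁ t) (H₂ t) t) (X t)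
  aemeasurable : AEMeasurable (fun q : ℝ × Ω => X q.1 q.2) ((volume.restrict (Icc 0 T)).prod P)

/-- The occupation measure `μ(A,B)(ω)`: Lebesgue measure of `{s ∈ A : X_s(ω) ∈ B}`. -/
def occupation {Ω : Type*} (X : ℝ → Ω → ℝ) (ω : Ω) (A B : Set ℝ) : ENNReal :=
  volume {s | s ∈ A ∧ X s ω ∈ B}

/-- `L` is a local time of `X` over the time set `A`: it is nonnegative, and for almost every `ω`
the function `L · ω` is the density of the occupation measure `B ↦ μ(A,B)(ω)` with respect to
Lebesgue measure. -/
def IsLocalTime {Ω : Type*} [MeasurableSpace Ω] (P : Measure Ω) (X : ℝ → Ω → ℝ) (A : Set ℝ)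
    (L : ℝ → Ω → ℝ) : Prop :=
  (∀ x ω, 0 ≤ L x ω) ∧
    ∀ᵐ ω ∂P, AEMeasurable (fun x => L x ω) volume ∧
      ∀ B : Set ℝ, MeasurableSet B → occupation X ω A B = ∫⁻ x in B, ENNReal.ofReal (L x ω)

/-- `X` has a square integrable local time on `[0,T]`: over every Borel `A ⊆ [0,T]` (in particular
`A = [0,T]`) there is a local time `L(A,x)(ω)` belonging to `L²(ℝ × Ω)`. -/
def HasSquareIntegrableLocalTime {Ω : Type*} [MeasurableSpace Ω] (P : Measure Ω) (T : ℝ)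
    (X : ℝ → Ω → ℝ) : Prop :=
  ∀ A : Set ℝ, MeasurableSet A → A ⊆ Icc 0 T →
    ∃ L : ℝ → Ω → ℝ, IsLocalTime P X A L ∧
      MemLp (fun q : ℝ × Ω => L q.1 q.2) 2 ((volume : Measure ℝ).prod P)

end Rosenblatt

end

/-! The occupation measure `ρ` of a path has an `L²` density as soon as the energies `(ρ × ρ){|x -
y| ≤ r} / 2r` have finite lower limit along some sequence `r → 0` (`withDensity_liminf_of_energy`).
In mean they are bounded if `P(|X_t - X_s| ≤ r) ≤ C r |t - s|^(-η)` with `η < 1`, because `|t -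
s|^(-η)` is integrable on the square (`exists_density_of_energy_le`). Such a small ball bound
follows from a bound `(1 + 4u²c²)⁻¹` on the characteristic function of the increment, with `c = κ (t
- s)^η`: its integral in `u` is of order `1/c` (`measure_abs_le_of_norm_charFun_le`).

An increment is a limit of Gaussian quadratic forms. In an eigenbasis the characteristic function of
such a form is a product of factors of modulus `(1 + 4u²λ²)^(-1/4)`, so four eigenvalues that are at
least `c` suffice, and these exist once the form is at least `c` on some four-dimensional space. The
bound is proved for simple kernels and then passed to the limit, so no spectral theory of the
limiting operator enters (`IsWienerMeasure.norm_charFun_sub_le`).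

The test space is spanned by the indicators of four intervals of length `δ (t - s)` inside `(s, t)`.
The kernel of `X_s` vanishes there, so only the kernel of `X_t` matters. With `h = (H₁ t + H₂ t) / 2
< 1` it is singular like `|x - y|^(h - 1)` at the diagonal, so for small `δ` the diagonal blocks
dominate (`increment_quadratic_form_ge`). Compactness of `[0, T]` bounds `h` by a single `η < 1`. -/

namespace Rosenblatt

/-! ### Characteristic functions of Gaussian quadratic forms. -/

section GaussianQuadraticForm

open scoped RealInnerProductSpace

/-- The integral equals `(1 - 2ia)^(-1/2)`. The fourth power of the modulus removes the root, and it
explains why four eigenvalues will be needed. -/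
lemma norm_integral_cexp_sq_gaussianReal_pow_four (a : ℝ) :
    ‖∫ x, Complex.exp (a * (x : ℂ) ^ 2 * Complex.I) ∂gaussianReal 0 1‖ ^ 4
      = (1 + 4 * a ^ 2)⁻¹ := by
  have hb : 0 < ((1 / 2 : ℂ) - a * Complex.I).re := by simp
  have h1 : ∫ x, Complex.exp (a * (x : ℂ) ^ 2 * Complex.I) ∂gaussianReal 0 1
      = ((√(2 * Real.pi))⁻¹ : ℝ) *
        ((Real.pi / ((1 / 2 : ℂ) - a * Complex.I)) ^ (1 / 2 : ℂ)) := by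
    rw [integral_gaussianReal_eq_integral_smul one_ne_zero, ← integral_gaussian_complex hb,
      ← integral_const_mul]
    refine integral_congr_ae (Eventually.of_forall fun x => ?_)
    simp only [gaussianPDFReal, NNReal.coe_one, mul_one, sub_zero, Complex.real_smul,
      Complex.ofReal_mul, mul_assoc, Complex.ofReal_exp, ← Complex.exp_add]
    congr 2
    push_cast
    ring
  have hn : ‖(1 / 2 : ℂ) - a * Complex.I‖ = √(1 / 4 + a ^ 2) := by
    rw [Complex.norm_def, Complex.normSq_apply]
    congr 1
    simp
    ring
  have h2 : ‖(Real.pi / ((1 / 2 : ℂ) - a * Complex.I)) ^ (1 / 2 : ℂ)‖ ^ 4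
      = Real.pi ^ 2 / (1 / 4 + a ^ 2) := by
    have : (1 / 2 : ℂ) = ((1 / 2 : ℝ) : ℂ) := by push_cast; rfl
    have hnn : 0 ≤ ‖(Real.pi : ℂ) / ((1 / 2 : ℂ) - a * Complex.I)‖ := norm_nonneg _
    have hexp : ‖((Real.pi : ℂ) / ((1 / 2 : ℂ) - a * Complex.I)) ^ (1 / 2 : ℂ)‖
        = ‖(Real.pi : ℂ) / ((1 / 2 : ℂ) - a * Complex.I)‖ ^ (1 / 2 : ℝ) := by
      conv_lhs => rw [show ((1 / 2 : ℂ)) = ((1 / 2 : ℝ) : ℂ) from this]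
      rw [Complex.norm_cpow_real, ← this]
    rw [hexp, ← Real.rpow_natCast, ← Real.rpow_mul hnn, norm_div, hn, Complex.norm_real,
      Real.norm_of_nonneg Real.pi_pos.le]
    norm_num
    rw [div_pow, Real.sq_sqrt (by positivity)]
  rw [h1, norm_mul, mul_pow, h2, Complex.norm_real, Real.norm_of_nonneg (by positivity), inv_pow,
    show (4 : ℕ) = 2 * 2 from rfl, pow_mul, Real.sq_sqrt (by positivity)]
  have := Real.pi_pos
  field_simp
  ring

variable {E : Type*} [NormedAddCommGroup E] [InnerProductSpace ℝ E] [FiniteDimensional ℝ E]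

/-- The quadratic form of a symmetric operator in an eigenbasis. -/
lemma inner_apply_self_eq_sum_eigenvalues {T : E →ₗ[ℝ] E} (hT : T.IsSymmetric) {n : ℕ}
    (hn : Module.finrank ℝ E = n) (x : E) :
    ⟪T x, x⟫ = ∑ k, hT.eigenvalues hn k * ⟪hT.eigenvectorBasis hn k, x⟫ ^ 2 := by
  rw [← (hT.eigenvectorBasis hn).sum_inner_mul_inner]
  refine Finset.sum_congr rfl fun k _ => ?_
  rw [hT x, hT.apply_eigenvectorBasis, inner_smul_right, real_inner_comm]
  simp
  ring

/-- A symmetric operator whose quadratic form is at least `c` on a space of dimension `m` has at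
least `m` eigenvalues that are at least `c`. -/
lemma card_le_card_eigenvalues_ge {T : E →ₗ[ℝ] E} (hT : T.IsSymmetric) {n m : ℕ}
    (hn : Module.finrank ℝ E = n) {c : ℝ} (w : (Fin m → ℝ) →ₗ[ℝ] E)
    (hw : ∀ v, v ≠ 0 → w v ≠ 0) (h : ∀ v, c * ‖w v‖ ^ 2 ≤ ⟪T (w v), w v⟫) :
    m ≤ (Finset.univ.filter fun k => c ≤ hT.eigenvalues hn k).card := by
  by_contra! hlt
  set S := Finset.univ.filter fun k => c ≤ hT.eigenvalues hn k
  -- With fewer than `m` large eigenvalues, some nonzero `v` has `w v` orthogonal to all their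
  -- eigenvectors; on such a vector the form is strictly below `c ‖w v‖ ^ 2`.
  let f : (Fin m → ℝ) →ₗ[ℝ] (S → ℝ) :=
    LinearMap.pi fun k => (innerₛₗ ℝ (hT.eigenvectorBasis hn k.1)).comp w
  have hker : f.ker ≠ ⊥ := LinearMap.ker_ne_bot_of_finrank_lt (by simpa using hlt)
  obtain ⟨v, hv, hv0⟩ := (Submodule.ne_bot_iff _).1 hker
  have hzero : ∀ k ∈ S, ⟪hT.eigenvectorBasis hn k, w v⟫ = 0 := fun k hk => by
    have := congrFun (LinearMap.mem_ker.1 hv) ⟨k, hk⟩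
    simpa [f] using this
  have h1 := h v
  rw [inner_apply_self_eq_sum_eigenvalues hT hn,
    ← (hT.eigenvectorBasis hn).sum_sq_inner_left (w v), Finset.mul_sum] at h1
  have hex : ∃ k, ⟪hT.eigenvectorBasis hn k, w v⟫ ≠ 0 := by
    by_contra! h0
    refine hw v hv0 ?_
    rw [← norm_eq_zero, ← sq_eq_zero_iff, ← (hT.eigenvectorBasis hn).sum_sq_inner_right (w v)]
    simp [h0]
  obtain ⟨k₀, hk₀⟩ := hex
  refine absurd h1 (not_le.2 (Finset.sum_lt_sum (fun k _ => ?_) ⟨k₀, Finset.mem_univ _, ?_⟩))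
  · by_cases hk : k ∈ S
    · simp [hzero k hk, real_inner_comm]
    · have : hT.eigenvalues hn k < c := by simpa [S] using hk
      rw [real_inner_comm]
      gcongr
  · have hk : k₀ ∉ S := fun hk => hk₀ (hzero k₀ hk)
    have : hT.eigenvalues hn k₀ < c := by simpa [S] using hk
    have hpos : 0 < ⟪hT.eigenvectorBasis hn k₀, w v⟫ ^ 2 := by positivity
    rw [real_inner_comm] at hpos
    rw [real_inner_comm]
    exact mul_lt_mul_of_pos_right this hpos

variable [MeasurableSpace E] [BorelSpace E]

/-- Decay of the characteristic function of a Gaussian quadratic form which is at least `c` on a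
four-dimensional space. -/
theorem norm_integral_cexp_quadratic_stdGaussian_le {T : E →ₗ[ℝ] E} (hT : T.IsSymmetric)
    {c : ℝ} (hc : 0 < c) (w : (Fin 4 → ℝ) →ₗ[ℝ] E) (hw : ∀ v, v ≠ 0 → w v ≠ 0)
    (h : ∀ v, c * ‖w v‖ ^ 2 ≤ ⟪T (w v), w v⟫) (u : ℝ) :
    ‖∫ x, Complex.exp (((u * ⟪T x, x⟫ : ℝ) : ℂ) * Complex.I) ∂stdGaussian E‖
      ≤ (1 + 4 * u ^ 2 * c ^ 2)⁻¹ := by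
  set b := hT.eigenvectorBasis rfl
  set l := hT.eigenvalues rfl
  set S := Finset.univ.filter fun k => c ≤ l k
  have hS : 4 ≤ S.card := card_le_card_eigenvalues_ge hT rfl w hw h
  let ρ : ℝ → ℝ := fun a =>
    ‖∫ x, Complex.exp (a * (x : ℂ) ^ 2 * Complex.I) ∂gaussianReal 0 1‖
  have hρ1 : ∀ a, ρ a ^ 4 = (1 + 4 * a ^ 2)⁻¹ := norm_integral_cexp_sq_gaussianReal_pow_four
  have heq : ‖∫ x, Complex.exp (((u * ⟪T x, x⟫ : ℝ) : ℂ) * Complex.I) ∂stdGaussian E‖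
      = ∏ k, ρ (u * l k) := by
    -- Rotation invariance: the coordinates in the eigenbasis are independent standard Gaussians, so
    -- the integral factorizes.
    rw [stdGaussian_eq_map_pi_orthonormalBasis b, integral_map
      (Measurable.aemeasurable (by fun_prop))]
    · have : ∀ x : Fin (Module.finrank ℝ E) → ℝ,
          Complex.exp (((u * ⟪T (∑ i, x i • b i), ∑ i, x i • b i⟫ : ℝ) : ℂ) * Complex.I)
            = ∏ k, Complex.exp (((u * l k : ℝ) : ℂ) * ((x k : ℝ) : ℂ) ^ 2 * Complex.I) := by
        intro x
        rw [inner_apply_self_eq_sum_eigenvalues hT rfl, ← Complex.exp_sum]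
        congr 1
        rw [← Finset.sum_mul]
        congr 1
        rw [Finset.mul_sum, Complex.ofReal_sum]
        refine Finset.sum_congr rfl fun k _ => ?_
        have : ⟪hT.eigenvectorBasis rfl k, ∑ i, x i • b i⟫ = x k := by
          simp [inner_sum, inner_smul_right, b, OrthonormalBasis.inner_eq_ite]
        rw [this]
        push_cast
        ring
      simp_rw [this]
      rw [integral_fintype_prod_eq_prod (𝕜 := ℂ)
        (f := fun k (y : ℝ) => Complex.exp (((u * l k : ℝ) : ℂ) * (y : ℂ) ^ 2 * Complex.I)),
        norm_prod]
    · have : Continuous T := T.continuous_of_finiteDimensional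
      exact (by fun_prop : Continuous fun x : E =>
        Complex.exp (((u * ⟪T x, x⟫ : ℝ) : ℂ) * Complex.I)).aestronglyMeasurable
  rw [heq]
  -- Every factor is at most one, so those outside `S` can be dropped; at least four factors remain,
  -- each bounded by the value at `c`.
  have h4 : (∏ k, ρ (u * l k)) ^ 4 ≤ ((1 + 4 * u ^ 2 * c ^ 2)⁻¹) ^ 4 := by
    have hq1 : (1 + 4 * u ^ 2 * c ^ 2)⁻¹ ≤ 1 := inv_le_one_of_one_le₀ (by nlinarith [sq_nonneg (u * c)])
    calc (∏ k, ρ (u * l k)) ^ 4 = ∏ k, (1 + 4 * (u * l k) ^ 2)⁻¹ := by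
          rw [← Finset.prod_pow]; exact Finset.prod_congr rfl fun k _ => hρ1 _
      _ ≤ ∏ k ∈ S, (1 + 4 * (u * l k) ^ 2)⁻¹ := by
          refine Finset.prod_le_prod_of_subset_of_le_one (Finset.filter_subset _ _)
            (fun k _ => by positivity) fun k _ _ => ?_
          exact inv_le_one_of_one_le₀ (by nlinarith [sq_nonneg (u * l k)])
      _ ≤ ∏ _k ∈ S, (1 + 4 * u ^ 2 * c ^ 2)⁻¹ := by
          refine Finset.prod_le_prod (fun k _ => by positivity) fun k hk => ?_
          have : c ≤ l k := by simpa [S] using hk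
          rw [mul_pow, ← mul_assoc]
          gcongr
      _ = ((1 + 4 * u ^ 2 * c ^ 2)⁻¹) ^ S.card := by rw [Finset.prod_const]
      _ ≤ _ := pow_le_pow_of_le_one (by positivity) hq1 hS
  exact (pow_le_pow_iff_left₀ (Finset.prod_nonneg fun k _ => norm_nonneg _) (by positivity)
    (by norm_num)).1 h4

end GaussianQuadraticForm

/-! ### Quadratic forms in the values of a Wiener measure. -/

section WienerQuadraticForm

open scoped RealInnerProductSpace

lemma sum_sum_comm_sum_sum {κ ι R : Type*} [Fintype κ] [Fintype ι] [AddCommMonoid R]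
    (F : κ → κ → ι → ι → R) :
    ∑ k, ∑ l, ∑ i, ∑ j, F k l i j = ∑ i, ∑ j, ∑ k, ∑ l, F k l i j := by
  calc _ = ∑ k, ∑ i, ∑ l, ∑ j, F k l i j := Finset.sum_congr rfl fun k _ => Finset.sum_comm
    _ = ∑ i, ∑ k, ∑ j, ∑ l, F k l i j := by
      rw [Finset.sum_comm]
      exact Finset.sum_congr rfl fun i _ => Finset.sum_congr rfl fun k _ => Finset.sum_comm
    _ = _ := Finset.sum_congr rfl fun i _ => Finset.sum_comm

/-- A quadratic form evaluated at linear combinations. -/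
lemma sum_mul_sum_mul_sum {κ ι : Type*} [Fintype κ] [Fintype ι] (b : κ → κ → ℝ) (v : ι → ℝ)
    (a : ι → κ → ℝ) :
    ∑ k, ∑ l, b k l * (∑ i, v i * a i k) * (∑ j, v j * a j l)
      = ∑ i, ∑ j, v i * v j * ∑ k, ∑ l, b k l * a i k * a j l := by
  simp_rw [mul_assoc (b _ _) (∑ i, _), Finset.sum_mul_sum, Finset.mul_sum]
  rw [sum_sum_comm_sum_sum]
  exact Finset.sum_congr rfl fun i _ => Finset.sum_congr rfl fun j _ =>
    Finset.sum_congr rfl fun k _ => Finset.sum_congr rfl fun l _ => by ring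

section atoms

variable {κ : Type*}

/-- The points that lie in exactly those members of the family `S` indexed by the nonempty set
`σ`. -/
def atom (S : κ → Set ℝ) (σ : Finset κ) : Set ℝ :=
  {x | σ.Nonempty ∧ ∀ k, x ∈ S k ↔ k ∈ σ}

lemma measurableSet_atom [Fintype κ] {S : κ → Set ℝ} (hS : ∀ k, MeasurableSet (S k))
    (σ : Finset κ) : MeasurableSet (atom S σ) := by
  have : atom S σ = {_x | σ.Nonempty} ∩ ⋂ k, {x | x ∈ S k ↔ k ∈ σ} := by
    ext x
    simp [atom]
  rw [this]
  refine (MeasurableSet.const _).inter (MeasurableSet.iInter fun k => ?_)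
  by_cases hk : k ∈ σ
  · simpa [hk] using hS k
  · simp only [hk, iff_false]
    exact (hS k).compl

lemma volume_atom_lt_top {S : κ → Set ℝ} (hfin : ∀ k, volume (S k) < ⊤) (σ : Finset κ) :
    volume (atom S σ) < ⊤ := by
  rcases σ.eq_empty_or_nonempty with rfl | ⟨k, hk⟩
  · simp [atom]
  · exact (measure_mono fun x hx => (hx.2 k).2 hk).trans_lt (hfin k)

lemma pairwise_disjoint_atom (S : κ → Set ℝ) :
    Pairwise fun σ τ => Disjoint (atom S σ) (atom S τ) := by
  refine fun σ τ hστ => Set.disjoint_left.2 fun x hx hx' => hστ ?_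
  ext k
  rw [← hx.2 k, hx'.2 k]

lemma iUnion_atom [Fintype κ] [DecidableEq κ] (S : κ → Set ℝ) (k : κ) :
    ⋃ σ ∈ Finset.univ.filter (fun σ : Finset κ => k ∈ σ), atom S σ = S k := by
  classical
  ext x
  simp only [mem_iUnion, Finset.mem_filter, Finset.mem_univ, true_and, exists_prop]
  constructor
  · rintro ⟨σ, hk, hx⟩
    exact (hx.2 k).2 hk
  · intro hx
    exact ⟨Finset.univ.filter fun l => x ∈ S l, by simpa using hx, ⟨k, by simpa using hx⟩,
      fun l => by simp⟩

lemma measureReal_inter_eq_sum_atom [Fintype κ] [DecidableEq κ] {S : κ → Set ℝ}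
    (hS : ∀ k, MeasurableSet (S k)) {A : Set ℝ} (hA : MeasurableSet A)
    (hfin : volume A < ⊤) (k : κ) :
    volume.real (A ∩ S k) = ∑ σ, (if k ∈ σ then 1 else 0) * volume.real (A ∩ atom S σ) := by
  conv_lhs => rw [← iUnion_atom S k, inter_iUnion₂]
  rw [measureReal_biUnion_finset]
  · simp [Finset.sum_filter]
  · exact fun σ _ τ _ h => ((pairwise_disjoint_atom S) h).mono inter_subset_right inter_subset_right
  · exact fun σ _ => hA.inter (measurableSet_atom hS σ)

end atoms

namespace IsWienerMeasure

variable {Ω : Type*} [MeasurableSpace Ω] {P : Measure Ω} {W : Set ℝ → Ω → ℝ}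

lemma biUnion_ae_eq (hW : IsWienerMeasure P W) {κ : Type*} {S : κ → Set ℝ}
    (hS : ∀ i, MeasurableSet (S i)) (hfin : ∀ i, volume (S i) < ⊤)
    (hdisj : Pairwise fun i j => Disjoint (S i) (S j)) (s : Finset κ) :
    W (⋃ i ∈ s, S i) =ᵐ[P] fun ω => ∑ i ∈ s, W (S i) ω := by
  classical
  induction s using Finset.induction_on with
  | empty =>
    -- Additivity for `∅ ∪ ∅` reads `W ∅ = 2 W ∅`, hence `W ∅ = 0` almost surely.
    filter_upwards [hW.additive ∅ ∅ .empty .empty (by simp) (by simp) (by simp)] with ω hω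
    simp only [union_empty] at hω
    simp
    linarith
  | insert k s hk ih =>
    have hfin' : volume (⋃ i ∈ s, S i) < ⊤ :=
      (measure_biUnion_finset_le _ _).trans_lt (ENNReal.sum_lt_top.2 fun i _ => hfin i)
    filter_upwards [ih, hW.additive (S k) (⋃ i ∈ s, S i) (hS k)
      (Finset.measurableSet_biUnion s fun i _ => hS i) (hfin k) hfin'
      (by
        simp only [disjoint_iUnion_right]
        exact fun i hi => hdisj fun h => hk (h ▸ hi))] with ω h1 h2
    rw [Finset.set_biUnion_insert, h2, Finset.sum_insert hk, h1]

variable [IsProbabilityMeasure P] {ι : Type*} [Fintype ι]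

/-- The values of a Wiener measure on finitely many disjoint sets are independent scaled standard
Gaussian variables. -/
lemma map_pi_eq (hW : IsWienerMeasure P W) {S : ι → Set ℝ} (hS : ∀ i, MeasurableSet (S i))
    (hfin : ∀ i, volume (S i) < ⊤) (hdisj : Pairwise fun i j => Disjoint (S i) (S j)) :
    P.map (fun ω i => W (S i) ω)
      = (stdGaussian (EuclideanSpace ℝ ι)).map fun x i => √(volume.real (S i)) * x i := by
  have hind : iIndepFun (fun i => W (S i)) P := by
    let e := Fintype.equivFin ι
    have := hW.indep _ (fun k => S (e.symm k)) (fun k => hS _) (fun k => hfin _)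
      fun j k hjk => hdisj (by simpa using hjk)
    simpa using this.precomp e.injective
  rw [(iIndepFun_iff_map_fun_eq_pi_map fun i => (hW.hasLaw _ (hS i) (hfin i)).aemeasurable).1 hind,
    ← map_pi_eq_stdGaussian, Measure.map_map (by fun_prop) (by fun_prop)]
  have : ∀ i, P.map (W (S i)) = (gaussianReal 0 1).map fun y => √(volume.real (S i)) * y := by
    intro i
    rw [(hW.hasLaw _ (hS i) (hfin i)).map_eq, gaussianReal_map_const_mul]
    congr 1
    · simp
    · ext
      simp [measureReal_def]
      rfl
  simp_rw [this]
  rw [← Measure.pi_map_pi fun i => by fun_prop]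
  rfl

/-- Bessel's inequality for indicators of disjoint sets tested against a disjoint family. -/
lemma sum_sq_div_le {S : ι → Set ℝ} (hS : ∀ i, MeasurableSet (S i))
    (hfin : ∀ i, volume (S i) < ⊤) (hdisj : Pairwise fun i j => Disjoint (S i) (S j))
    {m : ℕ} {A : Fin m → Set ℝ} (hA : ∀ i, MeasurableSet (A i)) (hAfin : ∀ i, volume (A i) < ⊤)
    (hAdisj : Pairwise fun i j => Disjoint (A i) (A j)) (v : Fin m → ℝ) :
    ∑ k, (∑ i, v i * volume.real (A i ∩ S k)) ^ 2 / volume.real (S k)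
      ≤ ∑ i, v i ^ 2 * volume.real (A i) := by
  -- Cauchy–Schwarz with weights `volume.real (A i ∩ S k)`, whose sum over `i` is at most
  -- `volume.real (S k)`. If that volume is zero, the quotient is zero by convention.
  have hle : ∀ k, (∑ i, v i * volume.real (A i ∩ S k)) ^ 2 / volume.real (S k)
      ≤ ∑ i, v i ^ 2 * volume.real (A i ∩ S k) := by
    intro k
    refine div_le_of_le_mul₀ measureReal_nonneg
      (Finset.sum_nonneg fun i _ => mul_nonneg (sq_nonneg _) measureReal_nonneg) ?_
    have h1 : ∑ i, volume.real (A i ∩ S k) ≤ volume.real (S k) := by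
      rw [← measureReal_iUnion_fintype (fun i j hij => (hAdisj hij).mono inter_subset_left
        inter_subset_left) (fun i => (hA i).inter (hS k))
        (fun i => (measure_mono inter_subset_left).trans_lt (hAfin i) |>.ne)]
      exact measureReal_mono (iUnion_subset fun i => inter_subset_right) (hfin k).ne
    have h2 := Finset.sum_sq_le_sum_mul_sum_of_sq_le_mul Finset.univ
      (r := fun i => v i * volume.real (A i ∩ S k)) (f := fun i => v i ^ 2 * volume.real (A i ∩ S k))
      (g := fun i => volume.real (A i ∩ S k))
      (fun i _ => mul_nonneg (sq_nonneg _) measureReal_nonneg) (fun i _ => measureReal_nonneg)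
      (fun i _ => le_of_eq (by ring))
    refine h2.trans (mul_le_mul_of_nonneg_left h1
      (Finset.sum_nonneg fun i _ => mul_nonneg (sq_nonneg _) measureReal_nonneg))
  refine (Finset.sum_le_sum fun k _ => hle k).trans ?_
  rw [Finset.sum_comm]
  refine Finset.sum_le_sum fun i _ => ?_
  rw [← Finset.mul_sum]
  refine mul_le_mul_of_nonneg_left ?_ (sq_nonneg _)
  rw [← measureReal_iUnion_fintype (fun j k hjk => (hdisj hjk).mono inter_subset_right
    inter_subset_right) (fun k => (hA i).inter (hS k))
    (fun k => (measure_mono inter_subset_left).trans_lt (hAfin i) |>.ne)]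
  exact measureReal_mono (iUnion_subset fun k => inter_subset_left) (hAfin i).ne

/-- Decay of the characteristic function of a quadratic form in the values of a Wiener measure on
disjoint sets. -/
lemma norm_charFun_quadratic_le_of_disjoint (hW : IsWienerMeasure P W) {S : ι → Set ℝ}
    (hS : ∀ i, MeasurableSet (S i))
    (hfin : ∀ i, volume (S i) < ⊤) (hdisj : Pairwise fun i j => Disjoint (S i) (S j))
    {b : ι → ι → ℝ} (hb : ∀ k j, b k j = b j k)
    {A : Fin 4 → Set ℝ} (hA : ∀ i, MeasurableSet (A i)) (hAfin : ∀ i, volume (A i) < ⊤)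
    (hApos : ∀ i, 0 < volume (A i))
    (hAdisj : Pairwise fun i j => Disjoint (A i) (A j)) {c : ℝ} (hc : 0 < c)
    (h : ∀ v : Fin 4 → ℝ, c * ∑ i, v i ^ 2 * volume.real (A i) ≤ ∑ i, ∑ j, v i * v j *
      ∑ k, ∑ l, b k l * volume.real (A i ∩ S k) * volume.real (A j ∩ S l)) (u : ℝ) :
    ‖∫ ω, Complex.exp (((u * ∑ k, ∑ l, b k l * W (S k) ω * W (S l) ω : ℝ) : ℂ) * Complex.I) ∂P‖
      ≤ (1 + 4 * u ^ 2 * c ^ 2)⁻¹ := by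
  classical
  -- The coefficient matrix in the normalized variables `W (S k) / √(volume.real (S k))`.
  let Q : Matrix ι ι ℝ := Matrix.of fun k l => √(volume.real (S k)) * b k l * √(volume.real (S l))
  have hQ : Q.IsHermitian := by
    ext k l
    simp only [Q, Matrix.conjTranspose_apply, Matrix.of_apply, star_trivial, hb l k]
    ring
  have hT := Matrix.isSymmetric_toEuclideanLin_iff.2 hQ
  have hQuad : ∀ x : EuclideanSpace ℝ ι, ⟪Matrix.toEuclideanLin Q x, x⟫
      = ∑ k, ∑ l, b k l * (√(volume.real (S k)) * x k) * (√(volume.real (S l)) * x l) := by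
    intro x
    simp only [PiLp.inner_apply, Matrix.toLpLin_apply, Matrix.mulVec, dotProduct,
      RCLike.inner_apply, conj_trivial, Q, Matrix.of_apply, Finset.mul_sum]
    exact Finset.sum_congr rfl fun k _ => Finset.sum_congr rfl fun l _ => by ring
  have hEq : ∫ ω, Complex.exp (((u * ∑ k, ∑ l, b k l * W (S k) ω * W (S l) ω : ℝ) : ℂ)
      * Complex.I) ∂P = ∫ x, Complex.exp (((u * ⟪Matrix.toEuclideanLin Q x, x⟫ : ℝ) : ℂ)
      * Complex.I) ∂stdGaussian (EuclideanSpace ℝ ι) := by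
    let g : (ι → ℝ) → ℂ := fun y =>
      Complex.exp (((u * ∑ k, ∑ l, b k l * y k * y l : ℝ) : ℂ) * Complex.I)
    have hg : Continuous g := by fun_prop
    have h1 := integral_map (μ := P) (φ := fun ω i => W (S i) ω) (f := g)
      (aemeasurable_pi_lambda _ fun i => (hW.hasLaw _ (hS i) (hfin i)).aemeasurable)
      hg.aestronglyMeasurable
    rw [hW.map_pi_eq hS hfin hdisj, integral_map (Measurable.aemeasurable (by fun_prop))
      hg.aestronglyMeasurable] at h1
    simp_rw [hQuad]
    exact h1.symm
  rw [hEq]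
  -- Coordinates of the projection of `∑ v i • 1_{A i}` onto the span of the `1_{S k}`, in the basis
  -- of normalized indicators. Projecting preserves the form and, by Bessel, does not increase the
  -- norm.
  let w : (Fin 4 → ℝ) →ₗ[ℝ] EuclideanSpace ℝ ι :=
    { toFun := fun v => WithLp.toLp 2 fun k =>
        (∑ i, v i * volume.real (A i ∩ S k)) / √(volume.real (S k))
      map_add' := fun v v' => by
        ext k
        simp [add_mul, Finset.sum_add_distrib, add_div]
      map_smul' := fun r v => by
        ext k
        simp [mul_assoc, ← Finset.mul_sum, mul_div_assoc] }
  have hwk : ∀ v k, √(volume.real (S k)) * w v k = ∑ i, v i * volume.real (A i ∩ S k) := by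
    intro v k
    change √(volume.real (S k)) * ((∑ i, v i * volume.real (A i ∩ S k)) / √(volume.real (S k))) = _
    -- For a null `S k` the division returns `0`, which is harmless since all intersections are null
    -- too.
    by_cases h0 : volume.real (S k) = 0
    · have : ∀ i, volume.real (A i ∩ S k) = 0 := fun i => le_antisymm
        (h0 ▸ measureReal_mono inter_subset_right (hfin k).ne) measureReal_nonneg
      simp [h0, this]
    · have : √(volume.real (S k)) ≠ 0 := by
        rw [Real.sqrt_ne_zero measureReal_nonneg]
        exact h0
      field_simp
  have hTw : ∀ v, ⟪Matrix.toEuclideanLin Q (w v), w v⟫ = ∑ i, ∑ j, v i * v j *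
      ∑ k, ∑ l, b k l * volume.real (A i ∩ S k) * volume.real (A j ∩ S l) := by
    intro v
    rw [hQuad]
    simp_rw [hwk]
    exact sum_mul_sum_mul_sum b v fun i k => volume.real (A i ∩ S k)
  have hnorm : ∀ v, ‖w v‖ ^ 2 ≤ ∑ i, v i ^ 2 * volume.real (A i) := by
    intro v
    rw [EuclideanSpace.real_norm_sq_eq]
    refine le_trans (le_of_eq ?_) (sum_sq_div_le hS hfin hdisj hA hAfin hAdisj v)
    refine Finset.sum_congr rfl fun k _ => ?_
    change ((∑ i, v i * volume.real (A i ∩ S k)) / √(volume.real (S k))) ^ 2 = _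
    rw [div_pow, Real.sq_sqrt measureReal_nonneg]
  refine norm_integral_cexp_quadratic_stdGaussian_le hT hc w (fun v hv h0 => ?_) (fun v => ?_) u
  -- Injectivity of `w` comes from the lower bound itself: the form is positive at every `v ≠ 0` but
  -- would vanish if `w v = 0`.
  · have h1 := h v
    rw [← hTw, h0] at h1
    obtain ⟨i, hi⟩ := Function.ne_iff.1 hv
    have : 0 < ∑ i, v i ^ 2 * volume.real (A i) :=
      Finset.sum_pos' (fun i _ => mul_nonneg (sq_nonneg _) measureReal_nonneg)
        ⟨i, Finset.mem_univ _, mul_pos (by have : v i ≠ 0 := hi; positivity)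
          (ENNReal.toReal_pos (hApos i).ne' (hAfin i).ne)⟩
    have h2 : 0 < c * ∑ i, v i ^ 2 * volume.real (A i) := mul_pos hc this
    simp at h1
    linarith
  · rw [hTw]
    exact (mul_le_mul_of_nonneg_left (hnorm v) hc.le).trans (h v)

/-- Decay of the characteristic function of a quadratic form in the values of a Wiener measure. -/
theorem norm_charFun_quadratic_le (hW : IsWienerMeasure P W) {S : ι → Set ℝ}
    (hS : ∀ i, MeasurableSet (S i)) (hfin : ∀ i, volume (S i) < ⊤)
    {b : ι → ι → ℝ} (hb : ∀ k j, b k j = b j k)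
    {A : Fin 4 → Set ℝ} (hA : ∀ i, MeasurableSet (A i)) (hAfin : ∀ i, volume (A i) < ⊤)
    (hApos : ∀ i, 0 < volume (A i))
    (hAdisj : Pairwise fun i j => Disjoint (A i) (A j)) {c : ℝ} (hc : 0 < c)
    (h : ∀ v : Fin 4 → ℝ, c * ∑ i, v i ^ 2 * volume.real (A i) ≤ ∑ i, ∑ j, v i * v j *
      ∑ k, ∑ l, b k l * volume.real (A i ∩ S k) * volume.real (A j ∩ S l)) (u : ℝ) :
    ‖∫ ω, Complex.exp (((u * ∑ k, ∑ l, b k l * W (S k) ω * W (S l) ω : ℝ) : ℂ) * Complex.I) ∂P‖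
      ≤ (1 + 4 * u ^ 2 * c ^ 2)⁻¹ := by
  classical
  -- The form is rewritten over the atoms of the family, which are disjoint. The new matrix `b'` may
  -- have a nonzero diagonal, so the disjoint case must allow one.
  let χ : Finset ι → ι → ℝ := fun σ k => if k ∈ σ then 1 else 0
  let b' : Finset ι → Finset ι → ℝ := fun σ τ => ∑ k, ∑ l, b k l * χ σ k * χ τ l
  have hquad : ∀ x y : Finset ι → ℝ, ∑ σ, ∑ τ, b' σ τ * x σ * y τ
      = ∑ k, ∑ l, b k l * (∑ σ, χ σ k * x σ) * (∑ τ, χ τ l * y τ) := by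
    intro x y
    simp_rw [mul_assoc (b _ _) (∑ i, _), Finset.sum_mul_sum, Finset.mul_sum, b', Finset.sum_mul]
    rw [sum_sum_comm_sum_sum]
    exact Finset.sum_congr rfl fun i _ => Finset.sum_congr rfl fun j _ =>
      Finset.sum_congr rfl fun k _ => Finset.sum_congr rfl fun l _ => by ring
  have hWS : ∀ᵐ ω ∂P, ∀ k, W (S k) ω = ∑ σ, χ σ k * W (atom S σ) ω := by
    refine ae_all_iff.2 fun k => ?_
    filter_upwards [hW.biUnion_ae_eq (measurableSet_atom hS) (volume_atom_lt_top hfin)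
      (pairwise_disjoint_atom S) (Finset.univ.filter (fun σ : Finset ι => k ∈ σ))] with ω hω
    rw [iUnion_atom] at hω
    simp [hω, χ, Finset.sum_filter]
  have hint : ∫ ω, Complex.exp (((u * ∑ k, ∑ l, b k l * W (S k) ω * W (S l) ω : ℝ) : ℂ)
      * Complex.I) ∂P = ∫ ω, Complex.exp (((u * ∑ σ, ∑ τ, b' σ τ * W (atom S σ) ω *
        W (atom S τ) ω : ℝ) : ℂ) * Complex.I) ∂P := by
    refine integral_congr_ae ?_
    filter_upwards [hWS] with ω hω
    rw [hquad]
    simp_rw [← hω]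
  rw [hint]
  refine hW.norm_charFun_quadratic_le_of_disjoint (measurableSet_atom hS) (volume_atom_lt_top hfin)
      (pairwise_disjoint_atom S) (fun σ τ => ?_) hA hAfin hApos hAdisj hc (fun v => ?_) u
  · simp only [b']
    rw [Finset.sum_comm]
    exact Finset.sum_congr rfl fun i _ => Finset.sum_congr rfl fun j _ => by rw [hb]; ring
  · simp_rw [hquad, χ, ← measureReal_inter_eq_sum_atom hS (hA _) (hAfin _)]
    exact h v

end IsWienerMeasure

end WienerQuadraticForm

/-! ### Passage from simple kernels to double integrals. -/

section DoubleIntegral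

namespace SimpleKernel

lemma integrable_toFun (F : SimpleKernel) : Integrable F.toFun (volume : Measure (ℝ × ℝ)) := by
  have hind : ∀ k, Integrable ((F.A k).indicator (1 : ℝ → ℝ)) volume := fun k =>
    (integrable_indicator_iff (F.measurableSet_A k)).2 (integrableOn_const (F.volume_A_lt_top k).ne)
  refine integrable_finsetSum _ fun k _ => integrable_finsetSum _ fun j _ => ?_
  simp only [mul_assoc]
  exact ((hind k).mul_prod (hind j)).const_mul (F.a k j)

lemma setIntegral_toFun (F : SimpleKernel) (A B : Set ℝ) :
    ∫ p in A ×ˢ B, F.toFun p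
      = ∑ k, ∑ j, F.a k j * volume.real (A ∩ F.A k) * volume.real (B ∩ F.A j) := by
  have hind : ∀ k, Integrable ((F.A k).indicator (1 : ℝ → ℝ)) volume := fun k =>
    (integrable_indicator_iff (F.measurableSet_A k)).2 (integrableOn_const (F.volume_A_lt_top k).ne)
  have hterm : ∀ k j, Integrable (fun p : ℝ × ℝ => F.a k j * (F.A k).indicator 1 p.1 *
      (F.A j).indicator 1 p.2) ((volume : Measure (ℝ × ℝ)).restrict (A ×ˢ B)) := fun k j => by
    simp only [mul_assoc]
    exact (((hind k).mul_prod (hind j)).const_mul (F.a k j)).restrict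
  simp only [toFun]
  rw [integral_finsetSum _ fun k _ => integrable_finsetSum _ fun j _ => hterm k j]
  refine Finset.sum_congr rfl fun k _ => ?_
  rw [integral_finsetSum _ fun j _ => hterm k j]
  refine Finset.sum_congr rfl fun j _ => ?_
  simp_rw [mul_assoc]
  rw [integral_const_mul, Measure.volume_eq_prod,
    setIntegral_prod_mul (fun x => (F.A k).indicator 1 x) (fun y => (F.A j).indicator 1 y)]
  simp [setIntegral_indicator (F.measurableSet_A _)]

end SimpleKernel

variable {Ω : Type*} [MeasurableSpace Ω] {P : Measure Ω} {W : Set ℝ → Ω → ℝ}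

lemma IsWienerMeasure.aestronglyMeasurable_integral (hW : IsWienerMeasure P W)
    (F : SimpleKernel) : AEStronglyMeasurable (F.integral W) P := by
  have : ∀ k, AEMeasurable (W (F.A k)) P := fun k =>
    (hW.hasLaw _ (F.measurableSet_A k) (F.volume_A_lt_top k)).aemeasurable
  unfold SimpleKernel.integral
  exact (by fun_prop : AEMeasurable _ P).aestronglyMeasurable

/-- The difference of two simple double integrals has a characteristic function that decays if the
difference of the kernels is positive on the span of four indicators. -/
lemma IsWienerMeasure.norm_charFun_integral_sub_le [IsProbabilityMeasure P]
    (hW : IsWienerMeasure P W) (F G : SimpleKernel)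
    {A : Fin 4 → Set ℝ} (hA : ∀ i, MeasurableSet (A i)) (hAfin : ∀ i, volume (A i) < ⊤)
    (hApos : ∀ i, 0 < volume (A i))
    (hAdisj : Pairwise fun i j => Disjoint (A i) (A j)) {c : ℝ} (hc : 0 < c)
    (h : ∀ v : Fin 4 → ℝ, c * ∑ i, v i ^ 2 * volume.real (A i) ≤ ∑ i, ∑ j, v i * v j *
      ((∫ p in A i ×ˢ A j, F.toFun p) - ∫ p in A i ×ˢ A j, G.toFun p)) (u : ℝ) :
    ‖∫ ω, Complex.exp (((u * (F.integral W ω - G.integral W ω) : ℝ) : ℂ) * Complex.I) ∂P‖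
      ≤ (1 + 4 * u ^ 2 * c ^ 2)⁻¹ := by
  -- The difference is one quadratic form over both families, with block diagonal matrix `diag(F.a,
  -- -G.a)`. Sets of different families may overlap.
  let S : Fin F.n ⊕ Fin G.n → Set ℝ := Sum.elim F.A G.A
  let b : Fin F.n ⊕ Fin G.n → Fin F.n ⊕ Fin G.n → ℝ :=
    Sum.elim (fun k => Sum.elim (F.a k) 0) fun k => Sum.elim 0 fun j => -G.a k j
  have hquad : ∀ x y : Fin F.n ⊕ Fin G.n → ℝ, ∑ k, ∑ l, b k l * x k * y l
      = ∑ k, ∑ l, F.a k l * x (.inl k) * y (.inl l)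
        - ∑ k, ∑ l, G.a k l * x (.inr k) * y (.inr l) := by
    intro x y
    simp [b, sub_eq_add_neg]
  have := hW.norm_charFun_quadratic_le (S := S) (b := b) (by
      rintro (k | k)
      exacts [F.measurableSet_A k, G.measurableSet_A k]) (by
      rintro (k | k)
      exacts [F.volume_A_lt_top k, G.volume_A_lt_top k]) (by
      rintro (k | k) (j | j)
      exacts [F.symm_a k j, rfl, rfl, congrArg _ (G.symm_a k j)]) hA hAfin hApos hAdisj hc
    (by
      intro v
      simp_rw [hquad, S, Sum.elim_inl, Sum.elim_inr, ← SimpleKernel.setIntegral_toFun]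
      exact h v) u
  simp_rw [hquad, S, Sum.elim_inl, Sum.elim_inr] at this
  exact this

/-- On a set of finite measure `L²` convergence implies `L¹` convergence. This carries the finitely
many entries of the tested form to the limit. -/
lemma tendsto_setIntegral_of_tendsto_eLpNorm_two {α : Type*} [MeasurableSpace α] {μ : Measure α}
    {F : ℕ → α → ℝ} {f : α → ℝ} (hF : ∀ n, Integrable (F n) μ) (hf : AEStronglyMeasurable f μ)
    (h : Tendsto (fun n => eLpNorm (fun p => F n p - f p) 2 μ) atTop (𝓝 0))
    {s : Set α} (hs : μ s ≠ ⊤) :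
    Tendsto (fun n => ∫ p in s, F n p ∂μ) atTop (𝓝 (∫ p in s, f p ∂μ)) := by
  refine tendsto_integral_of_L1' f hf.restrict (.of_forall fun n => (hF n).restrict) ?_
  have hle : ∀ n, eLpNorm (F n - f) 1 (μ.restrict s)
      ≤ eLpNorm (fun p => F n p - f p) 2 μ * μ s ^ (1 / (1 : ENNReal).toReal
        - 1 / (2 : ENNReal).toReal) := fun n => by
    refine (eLpNorm_le_eLpNorm_mul_rpow_measure_univ one_le_two
      ((hF n).aestronglyMeasurable.sub hf).restrict).trans ?_
    rw [Measure.restrict_apply_univ]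
    exact mul_le_mul_left (eLpNorm_restrict_le _ _ _ _) _
  refine tendsto_of_tendsto_of_tendsto_of_le_of_le tendsto_const_nhds ?_ (fun n => zero_le) hle
  have := ENNReal.Tendsto.mul_const (b := μ s ^ (1 / (1 : ENNReal).toReal
        - 1 / (2 : ENNReal).toReal)) h (Or.inr (ENNReal.rpow_ne_top_of_nonneg (by norm_num) hs))
  simpa using this

lemma norm_cexp_mul_I_sub_cexp_mul_I_le (x y : ℝ) :
    ‖Complex.exp (x * Complex.I) - Complex.exp (y * Complex.I)‖ ≤ ‖x - y‖ := by
  have : Complex.exp (x * Complex.I) - Complex.exp (y * Complex.I)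
      = Complex.exp (y * Complex.I) * (Complex.exp (Complex.I * ((x - y : ℝ) : ℂ)) - 1) := by
    rw [mul_sub, ← Complex.exp_add, mul_one]
    congr 2
    push_cast
    ring
  rw [this, norm_mul, Complex.norm_exp_ofReal_mul_I, one_mul]
  exact Real.norm_exp_I_mul_ofReal_sub_one_le

/-- The map `y ↦ exp(iuy)` is `|u|`-Lipschitz, and the `L¹` norm is at most the `L²` norm under a
probability measure. -/
lemma tendsto_charFun_of_tendsto_eLpNorm_two [IsProbabilityMeasure P] {ξ : ℕ → Ω → ℝ} {ζ : Ω → ℝ}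
    (hξ : ∀ n, AEStronglyMeasurable (ξ n) P) (hζ : AEStronglyMeasurable ζ P)
    (h : Tendsto (fun n => eLpNorm (fun ω => ξ n ω - ζ ω) 2 P) atTop (𝓝 0)) (u : ℝ) :
    Tendsto (fun n => ∫ ω, Complex.exp (((u * ξ n ω : ℝ) : ℂ) * Complex.I) ∂P) atTop
      (𝓝 (∫ ω, Complex.exp (((u * ζ ω : ℝ) : ℂ) * Complex.I) ∂P)) := by
  have hmeas : ∀ {η : Ω → ℝ}, AEStronglyMeasurable η P →
      AEStronglyMeasurable (fun ω => Complex.exp (((u * η ω : ℝ) : ℂ) * Complex.I)) P :=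
    fun hη => (by fun_prop : Continuous fun y : ℝ =>
      Complex.exp (((u * y : ℝ) : ℂ) * Complex.I)).comp_aestronglyMeasurable hη
  refine tendsto_integral_of_L1' _ (hmeas hζ) (.of_forall fun n => ?_) ?_
  · exact Integrable.of_bound (hmeas (hξ n)) 1 (.of_forall fun ω =>
      (Complex.norm_exp_ofReal_mul_I _).le)
  · refine tendsto_of_tendsto_of_tendsto_of_le_of_le tendsto_const_nhds ?_ (fun n => zero_le)
      (h := fun n => ENNReal.ofReal |u| * eLpNorm (fun ω => ξ n ω - ζ ω) 2 P) fun n => ?_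
    · simpa using ENNReal.Tendsto.const_mul (a := ENNReal.ofReal |u|) h
        (Or.inr ENNReal.ofReal_ne_top)
    · refine (eLpNorm_le_eLpNorm_of_exponent_le one_le_two
        ((hmeas (hξ n)).sub (hmeas hζ))).trans ?_
      refine eLpNorm_le_mul_eLpNorm_of_ae_le_mul (.of_forall fun ω => ?_) 2
      refine (norm_cexp_mul_I_sub_cexp_mul_I_le _ _).trans (le_of_eq ?_)
      rw [← mul_sub, norm_mul, Real.norm_eq_abs u]

/-- The difference of two double integrals has a characteristic function that decays if the
difference of the kernels is positive on the span of four indicators. -/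
theorem IsWienerMeasure.norm_charFun_sub_le [IsProbabilityMeasure P]
    (hW : IsWienerMeasure P W) {f g : ℝ × ℝ → ℝ} {ξ η : Ω → ℝ} (hf : IsDoubleIntegral P W f ξ)
    (hg : IsDoubleIntegral P W g η)
    {A : Fin 4 → Set ℝ} (hA : ∀ i, MeasurableSet (A i)) {a : ℝ} (ha : 0 < a)
    (hAvol : ∀ i, volume (A i) = ENNReal.ofReal a)
    (hAdisj : Pairwise fun i j => Disjoint (A i) (A j)) {c : ℝ} (hc : 0 < c)
    (h : ∀ v : Fin 4 → ℝ, 2 * c * a * ∑ i, v i ^ 2 ≤ ∑ i, ∑ j, v i * v j *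
      ((∫ p in A i ×ˢ A j, f p) - ∫ p in A i ×ˢ A j, g p)) (u : ℝ) :
    ‖∫ ω, Complex.exp (((u * (ξ ω - η ω) : ℝ) : ℂ) * Complex.I) ∂P‖
      ≤ (1 + 4 * u ^ 2 * c ^ 2)⁻¹ := by
  obtain ⟨hf2, hξ2, F, hF, hFI⟩ := hf
  obtain ⟨hg2, hη2, G, hG, hGI⟩ := hg
  have hAfin : ∀ i, volume (A i) < ⊤ := fun i => by simp [hAvol]
  have hprod : ∀ i j, volume (A i ×ˢ A j) ≠ ⊤ := fun i j => by
    rw [Measure.volume_eq_prod, Measure.prod_prod]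
    exact ENNReal.mul_ne_top (hAfin i).ne (hAfin j).ne
  have hM : ∀ i j, Tendsto (fun n => (∫ p in A i ×ˢ A j, (F n).toFun p)
      - ∫ p in A i ×ˢ A j, (G n).toFun p) atTop
      (𝓝 ((∫ p in A i ×ˢ A j, f p) - ∫ p in A i ×ˢ A j, g p)) := fun i j =>
    (tendsto_setIntegral_of_tendsto_eLpNorm_two (fun n => (F n).integrable_toFun)
      hf2.aestronglyMeasurable hF (hprod i j)).sub
    (tendsto_setIntegral_of_tendsto_eLpNorm_two (fun n => (G n).integrable_toFun)
      hg2.aestronglyMeasurable hG (hprod i j))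
  -- Since `(∑ |v i|)² ≤ 4 ∑ v i²`, an entrywise error `c * a / 4` costs at most `c * a * ∑ v i²`,
  -- half of the assumed lower bound.
  have hev : ∀ᶠ n in atTop, ∀ i j, |((∫ p in A i ×ˢ A j, (F n).toFun p)
      - ∫ p in A i ×ˢ A j, (G n).toFun p) - ((∫ p in A i ×ˢ A j, f p) - ∫ p in A i ×ˢ A j, g p)|
        < c * a / 4 := by
    refine eventually_all.2 fun i => eventually_all.2 fun j => ?_
    have := Metric.tendsto_nhds.1 (hM i j) (c * a / 4) (by positivity)
    simpa only [Real.dist_eq] using this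
  have hbound : ∀ᶠ n in atTop, ‖∫ ω, Complex.exp (((u * ((F n).integral W ω
      - (G n).integral W ω) : ℝ) : ℂ) * Complex.I) ∂P‖ ≤ (1 + 4 * u ^ 2 * c ^ 2)⁻¹ := by
    filter_upwards [hev] with n hn
    refine hW.norm_charFun_integral_sub_le (F n) (G n) hA hAfin (fun i => by simp [hAvol, ha])
      hAdisj hc (fun v => ?_) u
    set M := fun i j => ((∫ p in A i ×ˢ A j, f p) - ∫ p in A i ×ˢ A j, g p)
    set N := fun i j => ((∫ p in A i ×ˢ A j, (F n).toFun p) - ∫ p in A i ×ˢ A j, (G n).toFun p)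
    have hvol : ∀ i, volume.real (A i) = a := fun i => by
      simp [measureReal_def, hAvol, ha.le]
    simp_rw [hvol, ← Finset.sum_mul]
    have h1 : ∑ i, ∑ j, v i * v j * M i j - ∑ i, ∑ j, v i * v j * N i j
        ≤ ∑ i, ∑ j, |v i| * |v j| * (c * a / 4) := by
      simp_rw [← Finset.sum_sub_distrib]
      refine Finset.sum_le_sum fun i _ => Finset.sum_le_sum fun j _ => ?_
      rw [← mul_sub, ← abs_mul]
      refine (le_abs_self _).trans ?_
      rw [abs_mul, abs_sub_comm]
      exact mul_le_mul_of_nonneg_left (hn i j).le (abs_nonneg _)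
    have h2 : ∑ i, ∑ j, |v i| * |v j| * (c * a / 4) ≤ c * a * ∑ i, v i ^ 2 := by
      have := sq_sum_le_card_mul_sum_sq (s := Finset.univ) (f := fun i => |v i|)
      simp only [sq_abs, Finset.card_univ, Fintype.card_fin] at this
      simp_rw [← Finset.sum_mul, ← Finset.mul_sum, ← Finset.sum_mul, ← sq]
      have hca : 0 < c * a := by positivity
      push_cast at this
      nlinarith
    have h3 : 2 * c * a * ∑ i, v i ^ 2 ≤ ∑ i, ∑ j, v i * v j * M i j := h v
    change _ ≤ ∑ i, ∑ j, v i * v j * N i j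
    nlinarith
  refine le_of_tendsto (tendsto_charFun_of_tendsto_eLpNorm_two (fun n =>
    (hW.aestronglyMeasurable_integral (F n)).sub (hW.aestronglyMeasurable_integral (G n)))
    (hξ2.aestronglyMeasurable.sub hη2.aestronglyMeasurable) ?_ u).norm hbound
  refine tendsto_of_tendsto_of_tendsto_of_le_of_le tendsto_const_nhds
    (by simpa using hFI.add hGI) (fun n => zero_le) fun n => ?_
  have : (fun ω => ((F n).integral W - (G n).integral W) ω - (ξ - η) ω)
      = (fun ω => (F n).integral W ω - ξ ω) - fun ω => (G n).integral W ω - η ω := by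
    ext ω
    simp only [Pi.sub_apply]
    ring
  rw [this]
  exact eLpNorm_sub_le ((hW.aestronglyMeasurable_integral _).sub hξ2.aestronglyMeasurable)
    ((hW.aestronglyMeasurable_integral _).sub hη2.aestronglyMeasurable) one_le_two

end DoubleIntegral

/-! ### Estimates of the integrated kernel. -/

section IntegratedKernel

lemma posPow_nonneg (u α : ℝ) : 0 ≤ posPow u α := by
  unfold posPow
  split_ifs with h
  exacts [Real.rpow_nonneg h.le _, le_rfl]

lemma kernelK_nonneg (h₁ h₂ s x y : ℝ) : 0 ≤ kernelK h₁ h₂ s x y :=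
  add_nonneg (mul_nonneg (posPow_nonneg _ _) (posPow_nonneg _ _))
    (mul_nonneg (posPow_nonneg _ _) (posPow_nonneg _ _))

lemma kernelK_swap (h₁ h₂ s x y : ℝ) : kernelK h₁ h₂ s y x = kernelK h₁ h₂ s x y := by
  unfold kernelK
  ring

@[fun_prop]
lemma measurable_posPow (α : ℝ) : Measurable fun u => posPow u α :=
  Measurable.ite measurableSet_Ioi (by fun_prop) measurable_const

lemma intervalIntegrable_posPow {α : ℝ} (hα : -1 < α) (y a b : ℝ) :
    IntervalIntegrable (fun v => posPow (v - y) α) volume a b := by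
  have h0 : IntervalIntegrable (fun u => posPow u α) volume (a - y) (b - y) := by
    have h1 := intervalIntegral.intervalIntegrable_rpow' hα (a := a - y) (b := b - y)
    have h2 : (fun u => posPow u α) = (Ioi 0).indicator fun u => u ^ α := by
      ext u
      simp [posPow, indicator]
    rw [h2]
    exact ⟨h1.1.indicator measurableSet_Ioi, h1.2.indicator measurableSet_Ioi⟩
  simpa using h0.comp_sub_right y

lemma integral_posPow {α : ℝ} (hα : -1 < α) {y t : ℝ} (hy : 0 ≤ y) (hyt : y ≤ t) :
    ∫ v in (0 : ℝ)..t, posPow (v - y) α = (t - y) ^ (α + 1) / (α + 1) := by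
  rw [← intervalIntegral.integral_add_adjacent_intervals
    (intervalIntegrable_posPow hα y 0 y) (intervalIntegrable_posPow hα y y t)]
  have h1 : ∫ v in (0 : ℝ)..y, posPow (v - y) α = 0 := by
    rw [intervalIntegral.integral_congr (g := fun _ => 0), intervalIntegral.integral_zero]
    intro v hv
    rw [uIcc_of_le hy] at hv
    simp [posPow, hv.2]
  have h2 : ∫ v in y..t, posPow (v - y) α = ∫ v in y..t, (v - y) ^ α := by
    refine intervalIntegral.integral_congr_ae (.of_forall fun v hv => ?_)
    rw [uIoc_of_le hyt] at hv
    simp [posPow, hv.1]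
  rw [h1, h2, zero_add, intervalIntegral.integral_comp_sub_right (fun u => u ^ α), sub_self,
    integral_rpow (Or.inl hα), Real.zero_rpow (by linarith), sub_zero]

lemma posPow_mul_posPow_le {α : ℝ} (hα : α ≤ 0) (β : ℝ) {x y r : ℝ} (hr : 0 < r)
    (hxy : r ≤ y - x) (v : ℝ) :
    posPow (v - x) α * posPow (v - y) β ≤ r ^ α * posPow (v - y) β := by
  by_cases hv : 0 < v - y
  · refine mul_le_mul_of_nonneg_right ?_ (posPow_nonneg _ _)
    have : r ≤ v - x := by linarith
    rw [posPow, if_pos (by linarith)]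
    exact Real.rpow_le_rpow_of_nonpos hr this hα
  · simp [posPow, hv]

lemma kernelK_le {h₁ h₂ : ℝ} (h₁2 : h₁ ≤ 2) (h₂2 : h₂ ≤ 2) {x y r : ℝ} (hr : 0 < r)
    (hxy : r ≤ y - x) (v : ℝ) :
    kernelK h₁ h₂ v x y ≤ r ^ (h₁ / 2 - 1) * posPow (v - y) (h₂ / 2 - 1) +
      r ^ (h₂ / 2 - 1) * posPow (v - y) (h₁ / 2 - 1) :=
  add_le_add (posPow_mul_posPow_le (by linarith) _ hr hxy v)
    (posPow_mul_posPow_le (by linarith) _ hr hxy v)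

lemma intervalIntegrable_kernelK {h₁ h₂ : ℝ} (h₁0 : 0 < h₁) (h₂0 : 0 < h₂) (h₁2 : h₁ ≤ 2)
    (h₂2 : h₂ ≤ 2) {x y : ℝ} (hxy : x ≠ y) (a b : ℝ) :
    IntervalIntegrable (fun v => kernelK h₁ h₂ v x y) volume a b := by
  wlog hlt : x < y generalizing x y
  · simp_rw [← kernelK_swap h₁ h₂ _ x y]
    exact this hxy.symm (lt_of_le_of_ne (not_lt.1 hlt) hxy.symm)
  refine IntervalIntegrable.mono_fun
    (((intervalIntegrable_posPow (α := h₂ / 2 - 1) (by linarith) y a b).const_mul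
      ((y - x) ^ (h₁ / 2 - 1))).add
    ((intervalIntegrable_posPow (α := h₁ / 2 - 1) (by linarith) y a b).const_mul
      ((y - x) ^ (h₂ / 2 - 1)))) ?_ (.of_forall fun v => ?_)
  · refine Measurable.aestronglyMeasurable ?_
    have hm : ∀ z α : ℝ, Measurable fun v : ℝ => posPow (v - z) α := fun z α =>
      (measurable_posPow α).comp (by fun_prop)
    exact ((hm x _).mul (hm y _)).add ((hm x _).mul (hm y _))
  · beta_reduce
    rw [Real.norm_of_nonneg (kernelK_nonneg _ _ _ _ _)]
    exact (kernelK_le h₁2 h₂2 (sub_pos.2 hlt) le_rfl v).trans (Real.le_norm_self _)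

lemma rosenblattKernel_swap (h₁ h₂ t x y : ℝ) :
    rosenblattKernel h₁ h₂ t (y, x) = rosenblattKernel h₁ h₂ t (x, y) := by
  simp only [rosenblattKernel, kernelK_swap h₁ h₂ _ x y]

lemma rosenblattKernel_nonneg (h₁ h₂ : ℝ) {t : ℝ} (ht : 0 ≤ t) (p : ℝ × ℝ) :
    0 ≤ rosenblattKernel h₁ h₂ t p :=
  intervalIntegral.integral_nonneg ht fun _ _ => kernelK_nonneg _ _ _ _ _

/-- Each summand of the integrand contains a truncated power of `v - p.1 ≤ 0`. Hence the earlier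
variable of an increment contributes nothing to the form tested on `(s, t)²`. -/
lemma rosenblattKernel_eq_zero (h₁ h₂ : ℝ) {s : ℝ} (hs : 0 ≤ s) {p : ℝ × ℝ} (hp : s ≤ p.1) :
    rosenblattKernel h₁ h₂ s p = 0 := by
  rw [rosenblattKernel, intervalIntegral.integral_congr (g := fun _ => 0),
    intervalIntegral.integral_zero]
  intro v hv
  rw [uIcc_of_le hs] at hv
  have : ¬ 0 < v - p.1 := by linarith [hv.2]
  simp only [kernelK, posPow, if_neg this, zero_mul, add_zero]

/-- The integrated kernel near the diagonal is large. -/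
lemma le_rosenblattKernel {h₁ h₂ : ℝ} (hh₁ : h₁ ∈ Ioo (1 / 2 : ℝ) 1) (hh₂ : h₂ ∈ Ioo (1 / 2 : ℝ) 1)
    {a l t : ℝ} (ha : 0 ≤ a) (hl : 0 < l) (hat : a + 2 * l ≤ t) {x y : ℝ} (hxy : x ≠ y)
    (hx : x ∈ Ioo a (a + l)) (hy : y ∈ Ioo a (a + l)) :
    1 / 2 * l ^ ((h₁ + h₂) / 2 - 1) ≤ rosenblattKernel h₁ h₂ t (x, y) := by
  obtain ⟨h₁1, h₁2⟩ := hh₁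
  obtain ⟨h₂1, h₂2⟩ := hh₂
  have hint := intervalIntegrable_kernelK (h₁ := h₁) (h₂ := h₂) (by linarith) (by linarith)
    (by linarith) (by linarith) hxy
  have hpow : ∀ z ∈ Ioo a (a + l), ∀ v ∈ Ioo (a + l) (a + 2 * l), ∀ α ≤ (0 : ℝ),
      (2 * l) ^ α ≤ posPow (v - z) α := by
    intro z hz v hv α hα
    have h0 : 0 < v - z := by linarith [hz.2, hv.1]
    rw [posPow, if_pos h0]
    exact Real.rpow_le_rpow_of_nonpos h0 (by linarith [hz.1, hv.2]) hα
  have h2l : (0 : ℝ) < 2 * l := by positivity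
  -- It suffices to integrate over this interval: there `v - x` and `v - y` lie in `(0, 2l)`, and
  -- both exponents are negative.
  have hlow : ∀ v ∈ Ioo (a + l) (a + 2 * l),
      2 * (2 * l) ^ ((h₁ + h₂) / 2 - 2) ≤ kernelK h₁ h₂ v x y := by
    intro v hv
    have e : (2 * l) ^ ((h₁ + h₂) / 2 - 2) = (2 * l) ^ (h₁ / 2 - 1) * (2 * l) ^ (h₂ / 2 - 1) := by
      rw [← Real.rpow_add h2l]
      congr 1
      ring
    have hp : ∀ α : ℝ, 0 ≤ (2 * l) ^ α := fun α => Real.rpow_nonneg h2l.le α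
    rw [two_mul, kernelK, e]
    refine add_le_add ?_ ?_
    · exact mul_le_mul (hpow x hx v hv _ (by linarith)) (hpow y hy v hv _ (by linarith)) (hp _)
        (posPow_nonneg _ _)
    · rw [mul_comm]
      exact mul_le_mul (hpow x hx v hv _ (by linarith)) (hpow y hy v hv _ (by linarith)) (hp _)
        (posPow_nonneg _ _)
  have h1 : l * (2 * (2 * l) ^ ((h₁ + h₂) / 2 - 2)) ≤ ∫ v in (a + l)..(a + 2 * l),
      kernelK h₁ h₂ v x y := by
    have := intervalIntegral.integral_mono_on_of_le_Ioo (a := a + l) (b := a + 2 * l)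
      (by linarith) (f := fun _ => 2 * (2 * l) ^ ((h₁ + h₂) / 2 - 2))
      intervalIntegrable_const (hint _ _) hlow
    rw [intervalIntegral.integral_const, smul_eq_mul] at this
    convert! this using 1
    ring
  have h2 : ∫ v in (a + l)..(a + 2 * l), kernelK h₁ h₂ v x y ≤ rosenblattKernel h₁ h₂ t (x, y) :=
    intervalIntegral.integral_mono_interval (by linarith) (by linarith) hat
      (.of_forall fun v => kernelK_nonneg _ _ _ _ _) (hint _ _)
  refine le_trans ?_ (h1.trans h2)
  have e : l * (2 * (2 * l) ^ ((h₁ + h₂) / 2 - 2)) = (2 * l) ^ ((h₁ + h₂) / 2 - 1) := by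
    rw [show (h₁ + h₂) / 2 - 1 = ((h₁ + h₂) / 2 - 2) + 1 by ring, Real.rpow_add_one h2l.ne']
    ring
  rw [e, Real.mul_rpow two_pos.le hl.le]
  refine mul_le_mul_of_nonneg_right ?_ (Real.rpow_nonneg hl.le _)
  calc (1 / 2 : ℝ) = 2 ^ (-1 : ℝ) := by rw [Real.rpow_neg_one]; norm_num
    _ ≤ _ := Real.rpow_le_rpow_of_exponent_le one_le_two (by linarith)

/-- The integrated kernel away from the diagonal is bounded. -/
lemma rosenblattKernel_le {h₁ h₂ : ℝ} (hh₁ : h₁ ∈ Ioo (1 / 2 : ℝ) 1) (hh₂ : h₂ ∈ Ioo (1 / 2 : ℝ) 1)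
    {d t : ℝ} (hd : 0 < d) {x y : ℝ} (hxy : d / 8 ≤ y - x) (hy : 0 ≤ y) (hyt : y ≤ t)
    (hyd : t - d ≤ y) :
    rosenblattKernel h₁ h₂ t (x, y) ≤ 64 * d ^ ((h₁ + h₂) / 2 - 1) := by
  obtain ⟨h₁1, h₁2⟩ := hh₁
  obtain ⟨h₂1, h₂2⟩ := hh₂
  have hne : x ≠ y := by
    rintro rfl
    linarith
  have i₁ := intervalIntegrable_posPow (α := h₁ / 2 - 1) (by linarith) y 0 t
  have i₂ := intervalIntegrable_posPow (α := h₂ / 2 - 1) (by linarith) y 0 t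
  have hle : rosenblattKernel h₁ h₂ t (x, y) ≤
      ∫ v in (0 : ℝ)..t, ((d / 8) ^ (h₁ / 2 - 1) * posPow (v - y) (h₂ / 2 - 1) +
        (d / 8) ^ (h₂ / 2 - 1) * posPow (v - y) (h₁ / 2 - 1)) :=
    intervalIntegral.integral_mono_on (hy.trans hyt)
      (intervalIntegrable_kernelK (by linarith) (by linarith) (by linarith) (by linarith) hne 0 t)
      ((i₂.const_mul _).add (i₁.const_mul _))
      fun v _ => kernelK_le (by linarith) (by linarith) (by positivity) hxy v
  -- The separation `d / 8` costs `8 ^ (1 - p / 2) ≤ 8`, and the integration costs `2 / q ≤ 4`; the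
  -- two summands of the kernel give `2 · 32 = 64`.
  have hterm : ∀ p q : ℝ, p ∈ Ioo (1 / 2 : ℝ) 1 → q ∈ Ioo (1 / 2 : ℝ) 1 →
      (d / 8) ^ (p / 2 - 1) * ((t - y) ^ (q / 2 - 1 + 1) / (q / 2 - 1 + 1))
        ≤ 32 * d ^ ((p + q) / 2 - 1) := by
    rintro p q ⟨hp1, hp2⟩ ⟨hq1, hq2⟩
    have e1 : (d / 8) ^ (p / 2 - 1) ≤ 8 * d ^ (p / 2 - 1) := by
      rw [Real.div_rpow hd.le (by norm_num), div_eq_mul_inv, ← Real.rpow_neg (by norm_num), mul_comm]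
      refine mul_le_mul_of_nonneg_right ?_ (Real.rpow_nonneg hd.le _)
      calc (8 : ℝ) ^ (-(p / 2 - 1)) ≤ 8 ^ (1 : ℝ) :=
            Real.rpow_le_rpow_of_exponent_le (by norm_num) (by linarith)
        _ = 8 := Real.rpow_one 8
    have e2 : (t - y) ^ (q / 2 - 1 + 1) / (q / 2 - 1 + 1) ≤ 4 * d ^ (q / 2) := by
      rw [sub_add_cancel, div_le_iff₀ (by linarith)]
      have : (t - y) ^ (q / 2) ≤ d ^ (q / 2) :=
        Real.rpow_le_rpow (by linarith) (by linarith) (by linarith)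
      have hdq : 0 < d ^ (q / 2) := Real.rpow_pos_of_pos hd _
      nlinarith
    calc _ ≤ (8 * d ^ (p / 2 - 1)) * (4 * d ^ (q / 2)) :=
          mul_le_mul e1 e2 (div_nonneg (Real.rpow_nonneg (by linarith) _) (by linarith))
            (by positivity)
      _ = 32 * (d ^ (p / 2 - 1) * d ^ (q / 2)) := by ring
      _ = _ := by
          rw [← Real.rpow_add hd]
          congr 2
          ring
  rw [intervalIntegral.integral_add (i₂.const_mul _) (i₁.const_mul _),
    intervalIntegral.integral_const_mul, intervalIntegral.integral_const_mul,
    integral_posPow (by linarith) hy hyt, integral_posPow (by linarith) hy hyt] at hle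
  have t1 := hterm h₁ h₂ ⟨h₁1, h₁2⟩ ⟨h₂1, h₂2⟩
  have t2 := hterm h₂ h₁ ⟨h₂1, h₂2⟩ ⟨h₁1, h₁2⟩
  rw [add_comm h₂] at t2
  linarith

end IntegratedKernel

/-! ### Increments of the process. -/

section Increment

/-- By Cauchy–Schwarz the off-diagonal part is at most `U (∑ |v i|)² ≤ n U ∑ v i²`. -/
lemma sum_sum_mul_ge_of_diagonal_dominant {n : ℕ} {M : Fin n → Fin n → ℝ} {m U : ℝ} (hU : 0 ≤ U)
    (hdiag : ∀ i, m ≤ M i i) (hoff : ∀ i j, i ≠ j → |M i j| ≤ U) (v : Fin n → ℝ) :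
    (m - n * U) * ∑ i, v i ^ 2 ≤ ∑ i, ∑ j, v i * v j * M i j := by
  have h1 : ∀ i j, (if i = j then m * v i ^ 2 else 0) - U * (|v i| * |v j|) ≤ v i * v j * M i j := by
    intro i j
    split_ifs with hij
    · subst hij
      have := mul_le_mul_of_nonneg_left (hdiag i) (sq_nonneg (v i))
      have : 0 ≤ U * (|v i| * |v i|) := by positivity
      nlinarith
    · have := mul_le_mul_of_nonneg_left (hoff i j hij) (abs_nonneg (v i * v j))
      rw [← abs_mul] at this
      have := neg_abs_le (v i * v j * M i j)
      rw [zero_sub, ← abs_mul]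
      linarith
  refine le_trans ?_ (Finset.sum_le_sum fun i _ => Finset.sum_le_sum fun j _ => h1 i j)
  have h2 := sq_sum_le_card_mul_sum_sq (s := Finset.univ) (f := fun i => |v i|)
  simp only [sq_abs, Finset.card_univ, Fintype.card_fin] at h2
  simp only [Finset.sum_sub_distrib, Finset.sum_ite_eq, Finset.mem_univ, if_true]
  simp_rw [← Finset.mul_sum, ← Finset.sum_mul, ← sq]
  nlinarith

/-- The diagonal must be discarded because the kernel's lower bound can fail there: the
`s`-integrand has exponent `(h₁ + h₂) / 2 - 2 < -1`, and a non-integrable integrand yields the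
default value `0`. -/
lemma ae_fst_ne_snd : ∀ᵐ p : ℝ × ℝ, p.1 ≠ p.2 := by
  have hm : MeasurableSet {p : ℝ × ℝ | p.1 ≠ p.2} :=
    (measurableSet_eq_fun measurable_fst measurable_snd).compl
  rw [Measure.volume_eq_prod, Measure.ae_prod_iff_ae_ae hm]
  refine .of_forall fun x => ?_
  filter_upwards [compl_mem_ae_iff.2 (measure_singleton x)] with y hy
  exact fun h => hy h.symm

/-- Lower bound for the quadratic form of the kernel of an increment on the span of the indicators
of four intervals of length `δ (t - s)` inside `(s, t)`. -/
lemma increment_quadratic_form_ge {h₁ h₂ g₁ g₂ : ℝ} (hh₁ : h₁ ∈ Ioo (1 / 2 : ℝ) 1)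
    (hh₂ : h₂ ∈ Ioo (1 / 2 : ℝ) 1) {s t δ : ℝ} (hs : 0 ≤ s) (hst : s < t) (hδ : 0 < δ)
    (hδ8 : δ ≤ 1 / 8) (hδh : 1024 ≤ δ ^ ((h₁ + h₂) / 2 - 1))
    (hL : MemLp (rosenblattKernel h₁ h₂ t) 2 (volume : Measure (ℝ × ℝ)))
    {A : Fin 4 → Set ℝ} (hA : ∀ i : Fin 4, A i = Ioo (s + i * ((t - s) / 4))
      (s + i * ((t - s) / 4) + δ * (t - s))) (v : Fin 4 → ℝ) :
    1 / 4 * (δ * (t - s)) ^ ((h₁ + h₂) / 2 + 1) * ∑ i, v i ^ 2 ≤ ∑ i, ∑ j, v i * v j *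
      ((∫ p in A i ×ˢ A j, rosenblattKernel h₁ h₂ t p)
        - ∫ p in A i ×ˢ A j, rosenblattKernel g₁ g₂ s p) := by
  set d := t - s with hd
  set l := δ * d with hl
  have hd0 : 0 < d := sub_pos.2 hst
  have hl0 : 0 < l := mul_pos hδ hd0
  -- This separates consecutive intervals by at least `d / 8`, and leaves room for length `2l` after
  -- the last left endpoint `s + 3d/4`.
  have hl8 : l ≤ d / 8 := by nlinarith
  have hi4 : ∀ i : Fin 4, (0 : ℝ) ≤ i ∧ (i : ℝ) ≤ 3 := fun i =>
    ⟨by positivity, by exact_mod_cast Nat.le_of_lt_succ i.2⟩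
  have hAm : ∀ i, MeasurableSet (A i) := fun i => by rw [hA]; exact measurableSet_Ioo
  have hAv : ∀ i, volume.real (A i) = l := fun i => by
    rw [hA, measureReal_def, Real.volume_Ioo, ENNReal.toReal_ofReal] <;> linarith
  have hprod : ∀ i j, volume.real (A i ×ˢ A j) = l * l := fun i j => by
    rw [Measure.volume_eq_prod, measureReal_prod_prod, hAv, hAv]
  have hfin : ∀ i j, volume (A i ×ˢ A j) ≠ ⊤ := fun i j => by
    rw [hA, hA, Measure.volume_eq_prod, Measure.prod_prod]
    exact ENNReal.mul_ne_top (by simp) (by simp)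
  have hint : ∀ i j, IntegrableOn (rosenblattKernel h₁ h₂ t) (A i ×ˢ A j) := fun i j => by
    have : IsFiniteMeasure ((volume : Measure (ℝ × ℝ)).restrict (A i ×ˢ A j)) :=
      ⟨by simpa using (hfin i j).lt_top⟩
    exact (hL.restrict _).integrable one_le_two
  have hmem : ∀ i, ∀ x ∈ A i, s + i * (d / 4) < x ∧ x < s + i * (d / 4) + l := fun i x hx => by
    rw [hA] at hx
    exact hx
  have hzero : ∀ i j, ∫ p in A i ×ˢ A j, rosenblattKernel g₁ g₂ s p = 0 := fun i j =>
    setIntegral_eq_zero_of_forall_eq_zero fun p hp =>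
      rosenblattKernel_eq_zero _ _ hs (by nlinarith [(hmem i _ hp.1).1, (hi4 i).1])
  simp_rw [hzero, sub_zero]
  set h := (h₁ + h₂) / 2
  set U := 64 * d ^ (h - 1) * (l * l)
  have hU : 0 ≤ U := by positivity
  have hdiag : ∀ i, 1 / 2 * l ^ (h - 1) * (l * l) ≤ ∫ p in A i ×ˢ A i, rosenblattKernel h₁ h₂ t p := by
    intro i
    rw [← hprod i i, mul_comm, ← smul_eq_mul, ← setIntegral_const]
    refine setIntegral_mono_on_ae (integrableOn_const (hfin i i)) (hint i i)
      ((hAm i).prod (hAm i)) ?_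
    filter_upwards [ae_fst_ne_snd] with p hp hpA
    exact le_rosenblattKernel hh₁ hh₂ (a := s + i * (d / 4))
      (by nlinarith [(hi4 i).1]) hl0 (by nlinarith [(hi4 i).2]) hp (hmem i _ hpA.1) (hmem i _ hpA.2)
  have hlt : ∀ i j : Fin 4, i < j → ∀ x ∈ A i, ∀ y ∈ A j,
      rosenblattKernel h₁ h₂ t (x, y) ≤ 64 * d ^ (h - 1) := by
    intro i j hij x hx y hy
    have hij' : (i : ℝ) + 1 ≤ j := by exact_mod_cast hij
    have hx := hmem i x hx
    have hy := hmem j y hy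
    have := hi4 i
    have := hi4 j
    exact rosenblattKernel_le hh₁ hh₂ hd0 (by nlinarith) (by nlinarith) (by nlinarith)
      (by nlinarith)
  have hoff : ∀ i j, i ≠ j → |∫ p in A i ×ˢ A j, rosenblattKernel h₁ h₂ t p| ≤ U := by
    intro i j hij
    rw [← Real.norm_eq_abs]
    refine (norm_setIntegral_le_of_norm_le_const (hfin i j).lt_top fun p hp => ?_).trans
      (le_of_eq (by rw [hprod]))
    rw [Real.norm_of_nonneg (rosenblattKernel_nonneg _ _ (hs.trans hst.le) _)]
    rcases lt_or_gt_of_ne hij with hij | hij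
    · exact hlt i j hij _ hp.1 _ hp.2
    · have := hlt j i hij _ hp.2 _ hp.1
      rwa [rosenblattKernel_swap] at this
  refine le_trans ?_ (sum_sum_mul_ge_of_diagonal_dominant hU hdiag hoff v)
  refine mul_le_mul_of_nonneg_right ?_ (Finset.sum_nonneg fun i _ => sq_nonneg _)
  have e1 : l ^ (h + 1) = l ^ (h - 1) * (l * l) := by
    rw [show h + 1 = h - 1 + 1 + 1 by ring, Real.rpow_add_one hl0.ne', Real.rpow_add_one hl0.ne',
      mul_assoc]
  have e2 : l ^ (h - 1) = δ ^ (h - 1) * d ^ (h - 1) := Real.mul_rpow hδ.le hd0.le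
  have hdp : 0 < d ^ (h - 1) := Real.rpow_pos_of_pos hd0 _
  -- Here `256 = 4 · 64` is the total off-diagonal loss; absorbing it into half of the diagonal
  -- bound is what requires `δ ^ (h - 1) ≥ 1024`.
  have key : 256 * d ^ (h - 1) ≤ 1 / 4 * l ^ (h - 1) := by
    rw [e2]
    nlinarith
  have := mul_le_mul_of_nonneg_right key (mul_pos hl0 hl0).le
  rw [e1]
  simp only [U]
  push_cast
  linarith

variable {Ω : Type*} [MeasurableSpace Ω] {P : Measure Ω} {W : Set ℝ → Ω → ℝ}

/-- Decay of the characteristic functions of the increments of the multifractional generalized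
Rosenblatt process. -/
theorem exists_norm_charFun_increment_le [IsProbabilityMeasure P]
    (hW : IsWienerMeasure P W) {T : ℝ} (hT : 0 < T) {H₁ H₂ : ℝ → ℝ}
    (hH₁ : ∀ t ∈ Icc 0 T, H₁ t ∈ Ioo (1 / 2 : ℝ) 1)
    (hH₂ : ∀ t ∈ Icc 0 T, H₂ t ∈ Ioo (1 / 2 : ℝ) 1)
    (hcont₁ : ContinuousOn H₁ (Icc 0 T)) (hcont₂ : ContinuousOn H₂ (Icc 0 T))
    {X : ℝ → Ω → ℝ}
    (hX : ∀ t ∈ Icc 0 T, IsDoubleIntegral P W (rosenblattKernel (H₁ t) (H₂ t) t) (X t)) :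
    ∃ κ > 0, ∃ η ∈ Ioo (0 : ℝ) 1, ∀ s t, 0 ≤ s → s < t → t ≤ T → ∀ u : ℝ,
      ‖∫ ω, Complex.exp (((u * (X t ω - X s ω) : ℝ) : ℂ) * Complex.I) ∂P‖
        ≤ (1 + 4 * u ^ 2 * (κ * (t - s) ^ η) ^ 2)⁻¹ := by
  have hne : (Icc 0 T).Nonempty := nonempty_Icc.2 hT.le
  obtain ⟨t₁, ht₁, hm₁⟩ := isCompact_Icc.exists_isMaxOn hne hcont₁
  obtain ⟨t₂, ht₂, hm₂⟩ := isCompact_Icc.exists_isMaxOn hne hcont₂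
  set η := (H₁ t₁ + H₂ t₂) / 2
  have hη : η ∈ Ioo (0 : ℝ) 1 := by
    have h1 := hH₁ t₁ ht₁
    have h2 := hH₂ t₂ ht₂
    constructor <;> simp only [η] <;> linarith [h1.1, h1.2, h2.1, h2.2]
  have hη1 : 0 < 1 - η := by linarith [hη.2]
  -- The three bounds separate the intervals, give `δ (t - s) ≤ 1` so that powers decrease in the
  -- exponent, and make `δ ^ (η - 1) ≥ 1024`.
  set δ := min (min (1 / 8) (1 / T)) ((1024 : ℝ) ^ (-(1 / (1 - η))))
  have hδ : 0 < δ := by positivity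
  have hδ8 : δ ≤ 1 / 8 := (min_le_left _ _).trans (min_le_left _ _)
  have hδT : δ * T ≤ 1 := by
    rw [← le_div_iff₀ hT]
    exact (min_le_left _ _).trans (min_le_right _ _)
  have hδη : 1024 ≤ δ ^ (η - 1) := by
    calc (1024 : ℝ) = ((1024 : ℝ) ^ (-(1 / (1 - η)))) ^ (η - 1) := by
          rw [← Real.rpow_mul (by norm_num)]
          have : -(1 / (1 - η)) * (η - 1) = 1 := by
            field_simp
            ring
          rw [this, Real.rpow_one]
      _ ≤ δ ^ (η - 1) :=
          Real.rpow_le_rpow_of_nonpos hδ (min_le_right _ _) (by linarith)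
  -- With `l = δ (t - s)`, the form is at least `l ^ (h + 1) / 4 = 2 (l ^ h / 8) l`, and `l ^ h ≥ l
  -- ^ η`; hence `c = l ^ η / 8`.
  refine ⟨δ ^ η / 8, by positivity, η, hη, fun s t hs hst htT u => ?_⟩
  have htm : t ∈ Icc 0 T := ⟨by linarith, htT⟩
  have hsm : s ∈ Icc 0 T := ⟨hs, by linarith⟩
  have hh : (H₁ t + H₂ t) / 2 ≤ η := by
    have h1 : H₁ t ≤ H₁ t₁ := hm₁ htm
    have h2 : H₂ t ≤ H₂ t₂ := hm₂ htm
    simp only [η]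
    linarith
  have hd0 : 0 < t - s := sub_pos.2 hst
  have hl0 : 0 < δ * (t - s) := mul_pos hδ hd0
  have hl1 : δ * (t - s) ≤ 1 :=
    (mul_le_mul_of_nonneg_left (by linarith) hδ.le).trans hδT
  let A : Fin 4 → Set ℝ := fun i =>
    Ioo (s + i * ((t - s) / 4)) (s + i * ((t - s) / 4) + δ * (t - s))
  have hlt : ∀ i j : Fin 4, i < j → Disjoint (A i) (A j) := by
    intro i j hij
    refine Set.disjoint_left.2 fun x hx hy => ?_
    have hij' : (i : ℝ) + 1 ≤ j := by exact_mod_cast hij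
    nlinarith [hx.2, hy.1]
  refine hW.norm_charFun_sub_le (hX t htm) (hX s hsm) (A := A) (fun i => measurableSet_Ioo) hl0
    (fun i => by simp [A]) (fun i j hij => ?_) (by positivity) (fun v => ?_) u
  · rcases lt_or_gt_of_ne hij with hij | hij
    exacts [hlt i j hij, (hlt j i hij).symm]
  · refine le_trans ?_ (increment_quadratic_form_ge (hH₁ t htm) (hH₂ t htm) hs hst hδ hδ8
      (hδη.trans (Real.rpow_le_rpow_of_exponent_ge hδ (by linarith) (by linarith)))
      (hX t htm).1 (fun i => rfl) v)
    refine mul_le_mul_of_nonneg_right ?_ (Finset.sum_nonneg fun i _ => sq_nonneg _)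
    have e : (δ * (t - s)) ^ η ≤ (δ * (t - s)) ^ ((H₁ t + H₂ t) / 2) :=
      Real.rpow_le_rpow_of_exponent_ge hl0 hl1 hh
    rw [Real.rpow_add_one hl0.ne']
    rw [Real.mul_rpow hδ.le hd0.le] at e
    nlinarith

end Increment

/-! ### Small ball probabilities from characteristic functions. -/

section SmallBall

/-- A small ball estimate from the decay of the characteristic function. -/
theorem measure_abs_le_of_norm_charFun_le {Ω : Type*} [MeasurableSpace Ω] {P : Measure Ω}
    [IsProbabilityMeasure P] {Z : Ω → ℝ} (hZ : Measurable Z) {c : ℝ} (hc : 0 < c)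
    (h : ∀ u : ℝ, ‖∫ ω, Complex.exp (((u * Z ω : ℝ) : ℂ) * Complex.I) ∂P‖
      ≤ (1 + 4 * u ^ 2 * c ^ 2)⁻¹) {r : ℝ} (hr : 0 < r) :
    P {ω | |Z ω| ≤ r} ≤ ENNReal.ofReal (4 * r / c) := by
  -- With variance `r⁻²`, the Gaussian characteristic function is the smooth cutoff `exp(-z² / 2r²)`
  -- at scale `r`, and the density is bounded by `r`. Fubini then moves the problem to the
  -- characteristic function of `Z`.
  let V : NNReal := ⟨(r ^ 2)⁻¹, by positivity⟩
  have hV : V ≠ 0 := by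
    intro h0
    have : (r ^ 2)⁻¹ = 0 := congrArg NNReal.toReal h0
    have : 0 < (r ^ 2)⁻¹ := by positivity
    linarith
  let γ := gaussianReal 0 V
  have hgauss : ∀ z : ℝ, ∫ u, Complex.exp (((u * z : ℝ) : ℂ) * Complex.I) ∂γ
      = (Real.exp (-(z ^ 2 / (2 * r ^ 2))) : ℝ) := by
    intro z
    have h1 := charFun_gaussianReal (μ := 0) (v := V) z
    rw [charFun_apply_real] at h1
    have e : ∀ u : ℝ, ((u * z : ℝ) : ℂ) = (z : ℂ) * (u : ℂ) := fun u => by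
      push_cast
      ring
    simp_rw [e]
    rw [h1, Complex.ofReal_exp]
    congr 1
    have : ((V : ℝ) : ℂ) = ((r : ℂ) ^ 2)⁻¹ := by
      change (((r ^ 2)⁻¹ : ℝ) : ℂ) = _
      push_cast
      rfl
    rw [this]
    push_cast
    have hr' : (r : ℂ) ≠ 0 := by exact_mod_cast hr.ne'
    field_simp
    ring
  have hmeas : Measurable fun p : Ω × ℝ => Complex.exp (((p.2 * Z p.1 : ℝ) : ℂ) * Complex.I) := by
    fun_prop
  have hswap : ∫ ω, ∫ u, Complex.exp (((u * Z ω : ℝ) : ℂ) * Complex.I) ∂γ ∂P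
      = ∫ u, ∫ ω, Complex.exp (((u * Z ω : ℝ) : ℂ) * Complex.I) ∂P ∂γ := by
    refine integral_integral_swap ?_
    exact Integrable.of_bound hmeas.aestronglyMeasurable 1 (.of_forall fun p =>
      (Complex.norm_exp_ofReal_mul_I _).le)
  simp_rw [hgauss] at hswap
  rw [integral_complex_ofReal] at hswap
  have hpdf : ∀ u, gaussianPDFReal 0 V u ≤ r := by
    intro u
    have h1 : (√(2 * Real.pi * V))⁻¹ ≤ r := by
      change (√(2 * Real.pi * (r ^ 2)⁻¹))⁻¹ ≤ r
      rw [Real.sqrt_mul (by positivity), Real.sqrt_inv, Real.sqrt_sq hr.le, mul_inv, inv_inv]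
      have : (√(2 * Real.pi))⁻¹ ≤ 1 := by
        refine inv_le_one_of_one_le₀ (Real.one_le_sqrt.2 ?_)
        linarith [Real.pi_gt_three]
      nlinarith
    have h2 : Real.exp (-(u - 0) ^ 2 / (2 * V)) ≤ 1 := by
      rw [Real.exp_le_one_iff, neg_div]
      exact neg_nonpos.2 (by positivity)
    exact (mul_le_of_le_one_right (by positivity) h2).trans h1
  have hInt : Integrable (fun u : ℝ => (1 + 4 * u ^ 2 * c ^ 2)⁻¹) := by
    have := integrable_inv_one_add_sq.comp_mul_left' (R := 2 * c) (by positivity)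
    convert this using 3 with u
    ring
  have hIval : ∫ u : ℝ, (1 + 4 * u ^ 2 * c ^ 2)⁻¹ = Real.pi / (2 * c) := by
    have := Measure.integral_comp_mul_left (fun u : ℝ => (1 + u ^ 2)⁻¹) (2 * c)
    rw [integral_univ_inv_one_add_sq, abs_of_pos (by positivity)] at this
    rw [div_eq_inv_mul, ← smul_eq_mul, ← this]
    congr 1
    ext u
    congr 1
    ring
  have hle : ∫ ω, Real.exp (-(Z ω ^ 2 / (2 * r ^ 2))) ∂P ≤ r * (Real.pi / (2 * c)) := by
    have h1 : ∫ ω, Real.exp (-(Z ω ^ 2 / (2 * r ^ 2))) ∂P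
        = ‖((∫ ω, Real.exp (-(Z ω ^ 2 / (2 * r ^ 2))) ∂P : ℝ) : ℂ)‖ := by
      rw [Complex.norm_real, Real.norm_of_nonneg (integral_nonneg fun ω => (Real.exp_pos _).le)]
    rw [h1, hswap]
    calc _ ≤ ∫ u, (1 + 4 * u ^ 2 * c ^ 2)⁻¹ ∂γ := by
          refine norm_integral_le_of_norm_le ?_ (.of_forall h)
          refine Integrable.of_bound (Measurable.aestronglyMeasurable (by fun_prop)) 1
            (.of_forall fun u => ?_)
          rw [Real.norm_of_nonneg (by positivity)]
          exact inv_le_one_of_one_le₀ (by nlinarith [sq_nonneg (u * c)])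
      _ = ∫ u, gaussianPDFReal 0 V u * (1 + 4 * u ^ 2 * c ^ 2)⁻¹ := by
          rw [integral_gaussianReal_eq_integral_smul hV]
          rfl
      _ ≤ ∫ u, r * (1 + 4 * u ^ 2 * c ^ 2)⁻¹ := by
          refine integral_mono_of_nonneg (.of_forall fun u => ?_) (hInt.const_mul r)
            (.of_forall fun u => ?_)
          · exact mul_nonneg (gaussianPDFReal_nonneg _ _ _) (by positivity)
          · exact mul_le_mul_of_nonneg_right (hpdf u) (by positivity)
      _ = _ := by rw [integral_const_mul, hIval]
  -- On the ball the cutoff is at least `exp(-1/2) ≥ 1/2`.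
  have hmarkov : (1 / 2 : ℝ) * P.real {ω | |Z ω| ≤ r}
      ≤ ∫ ω, Real.exp (-(Z ω ^ 2 / (2 * r ^ 2))) ∂P := by
    have hi : Integrable (fun ω => Real.exp (-(Z ω ^ 2 / (2 * r ^ 2)))) P := by
      refine Integrable.of_bound (Measurable.aestronglyMeasurable (by fun_prop)) 1
        (.of_forall fun ω => ?_)
      rw [Real.norm_of_nonneg (Real.exp_pos _).le, Real.exp_le_one_iff]
      exact neg_nonpos.2 (by positivity)
    refine le_trans ?_ (mul_meas_ge_le_integral_of_nonneg (.of_forall fun ω =>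
      (Real.exp_pos _).le) hi (1 / 2))
    refine mul_le_mul_of_nonneg_left (measureReal_mono fun ω hω => ?_) (by norm_num)
    have hω : |Z ω| ≤ r := hω
    have h1 : Z ω ^ 2 ≤ r ^ 2 := sq_le_sq' (by linarith [neg_abs_le (Z ω)])
      ((le_abs_self _).trans hω)
    have h2 : Z ω ^ 2 / (2 * r ^ 2) ≤ 1 / 2 := by
      rw [div_le_iff₀ (by positivity)]
      linarith
    have h3 := Real.add_one_le_exp (-(Z ω ^ 2 / (2 * r ^ 2)))
    change 1 / 2 ≤ Real.exp _
    linarith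
  rw [ENNReal.le_ofReal_iff_toReal_le (measure_ne_top _ _) (by positivity)]
  change P.real _ ≤ _
  have : r * (Real.pi / (2 * c)) ≤ r * (4 / (2 * c)) := by
    gcongr
    exact Real.pi_le_four
  calc P.real {ω | |Z ω| ≤ r} ≤ 2 * (r * (4 / (2 * c))) := by linarith
    _ = 4 * r / c := by
      field_simp

end SmallBall

/-! ### Densities of measures of finite energy. -/

section OccupationDensity

/-- A finite measure on the line with finite energy is absolutely continuous, with square
integrable density given by symmetric derivatives. -/
theorem withDensity_liminf_of_energy (ρ : Measure ℝ) [IsFiniteMeasure ρ] {r : ℕ → ℝ}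
    (hr : Tendsto r atTop (𝓝[>] 0)) {g : ℕ → ℝ → ENNReal}
    (hg : ∀ n x, g n x = ρ (Metric.closedBall x (r n)) / volume (Metric.closedBall x (r n)))
    (hgm : ∀ n, Measurable (g n)) (hfin : liminf (fun n => ∫⁻ x, g n x ∂ρ) atTop ≠ ⊤) :
    ρ = volume.withDensity (fun x => liminf (fun n => g n x) atTop) ∧
      ∫⁻ x, (liminf (fun n => g n x) atTop) ^ 2 ≤ liminf (fun n => ∫⁻ x, g n x ∂ρ) atTop := by
  have hGm : Measurable fun x => liminf (fun n => g n x) atTop := Measurable.liminf hgm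
  have hG : ∫⁻ x, liminf (fun n => g n x) atTop ∂ρ ≤ liminf (fun n => ∫⁻ x, g n x ∂ρ) atTop :=
    lintegral_liminf_le hgm
  have hG' : ∀ᵐ x ∂ρ, liminf (fun n => g n x) atTop < ⊤ :=
    ae_lt_top hGm (hG.trans_lt (lt_top_iff_ne_top.2 hfin)).ne
  -- By Besicovitch differentiation, the reciprocals of `g n x` converge `ρ`-almost everywhere to
  -- this derivative. A zero limit would force `g n x → ∞`, against the finite lower limit.
  have hpos : ∀ᵐ x ∂ρ, (volume : Measure ℝ).rnDeriv ρ x ≠ 0 := by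
    filter_upwards [hG', Besicovitch.ae_tendsto_rnDeriv (volume : Measure ℝ) ρ] with x hx hlim h0
    have h1 := (tendsto_inv_iff.2 hlim).comp hr
    rw [h0, ENNReal.inv_zero] at h1
    have h2 : (fun n => g n x) =ᶠ[atTop] (fun s => (volume (Metric.closedBall x s) /
        ρ (Metric.closedBall x s))⁻¹) ∘ r := by
      filter_upwards [hr self_mem_nhdsWithin] with n hn
      have hn : 0 < r n := hn
      simp only [Function.comp, hg]
      rw [ENNReal.inv_div (Or.inl (measure_ne_top _ _))
        (Or.inr (by simpa [Real.volume_closedBall] using hn))]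
    exact hx.ne (h1.congr' h2.symm).liminf_eq
  -- On a Lebesgue null set, the `ρ`-integral of this almost everywhere positive derivative is zero,
  -- so the set is `ρ`-null.
  have hac : ρ ≪ volume := by
    refine Measure.AbsolutelyContinuous.mk fun s hs h0 => ?_
    have h1 : ∫⁻ x in s, (volume : Measure ℝ).rnDeriv ρ x ∂ρ = 0 :=
      le_antisymm ((Measure.setLIntegral_rnDeriv_le s).trans h0.le) zero_le
    rw [lintegral_eq_zero_iff (Measure.measurable_rnDeriv _ _)] at h1
    have h2 : ∀ᵐ x ∂ρ.restrict s, False := by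
      filter_upwards [h1, ae_restrict_of_ae hpos] with x hx hx'
      exact hx' hx
    simpa using h2
  have hGeq : (fun x => liminf (fun n => g n x) atTop) =ᵐ[volume] ρ.rnDeriv volume := by
    filter_upwards [Besicovitch.ae_tendsto_rnDeriv ρ (volume : Measure ℝ)] with x hlim
    have h1 := hlim.comp hr
    have h2 : (fun n => g n x) = (fun s => ρ (Metric.closedBall x s) /
        volume (Metric.closedBall x s)) ∘ r := by
      ext n
      exact hg n x
    rw [← h2] at h1
    exact h1.liminf_eq
  have hwd : ρ = volume.withDensity (fun x => liminf (fun n => g n x) atTop) := by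
    rw [withDensity_congr_ae hGeq, Measure.withDensity_rnDeriv_eq _ _ hac]
  -- If `ρ` has density `G`, then `∫ G² dx = ∫ G dρ`.
  refine ⟨hwd, le_trans (le_of_eq ?_) hG⟩
  conv_rhs => rw [hwd, lintegral_withDensity_eq_lintegral_mul _ hGm hGm]
  simp only [Pi.mul_apply, sq]

variable {Ω : Type*} [MeasurableSpace Ω] {P : Measure Ω} [IsProbabilityMeasure P]

/-- If the expected energies of the occupation measures are bounded at small scales, then the
occupation measures have a jointly measurable, square integrable density. -/
theorem exists_density_of_energy_le {Y : ℝ × Ω → ℝ} (hY : Measurable Y) (ν : Measure ℝ)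
    [IsFiniteMeasure ν] {C : ENNReal} (hC : C ≠ ⊤)
    (h : ∀ r : ℝ, 0 < r → ∫⁻ s, ∫⁻ t, P {ω | |Y (t, ω) - Y (s, ω)| ≤ r} ∂ν ∂ν
      ≤ C * ENNReal.ofReal (2 * r)) :
    ∃ G : ℝ × Ω → ENNReal, Measurable G ∧ ∫⁻ q, G q ^ 2 ∂((volume : Measure ℝ).prod P) < ⊤ ∧
      ∀ᵐ ω ∂P, ν.map (fun s => Y (s, ω)) = volume.withDensity fun x => G (x, ω) := by
  let r : ℕ → ℝ := fun n => 1 / ((n : ℝ) + 1)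
  have hrpos : ∀ n, 0 < r n := fun n => by positivity
  have hr : Tendsto r atTop (𝓝[>] 0) := tendsto_nhdsWithin_iff.2
    ⟨tendsto_one_div_add_atTop_nhds_zero_nat, .of_forall hrpos⟩
  have hYω : ∀ ω, Measurable fun s => Y (s, ω) := fun ω => hY.comp (by fun_prop)
  let ρ : Ω → Measure ℝ := fun ω => ν.map fun s => Y (s, ω)
  let B : ℕ → Set ((ℝ × Ω) × ℝ) := fun n => {q | dist (Y (q.2, q.1.2)) q.1.1 ≤ r n}
  have hB : ∀ n, MeasurableSet (B n) := fun n => by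
    refine measurableSet_le (Measurable.dist (hY.comp (by fun_prop)) (by fun_prop))
      measurable_const
  -- These ball averages are jointly measurable in `(x, ω)`, and so is their lower limit; no
  -- measurable choice of densities over `ω` is needed.
  let g : ℕ → ℝ × Ω → ENNReal := fun n q => ν (Prod.mk q ⁻¹' B n) / ENNReal.ofReal (2 * r n)
  have hgm : ∀ n, Measurable (g n) := fun n =>
    (measurable_measure_prodMk_left (hB n)).div_const _
  have hg : ∀ n ω x, g n (x, ω) = ρ ω (Metric.closedBall x (r n)) /
      volume (Metric.closedBall x (r n)) := fun n ω x => by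
    rw [Real.volume_closedBall, Measure.map_apply (hYω ω) Metric.isClosed_closedBall.measurableSet]
    rfl
  have hlint : ∀ n ω, ∫⁻ x, g n (x, ω) ∂(ρ ω) = ∫⁻ s, g n (Y (s, ω), ω) ∂ν := fun n ω =>
    lintegral_map ((hgm n).comp (by fun_prop)) (hYω ω)
  have hJm : ∀ n, Measurable fun q : Ω × ℝ => g n (Y (q.2, q.1), q.1) := fun n =>
    (hgm n).comp ((hY.comp (by fun_prop)).prodMk measurable_fst)
  have henergy : ∀ n, ∫⁻ ω, ∫⁻ s, g n (Y (s, ω), ω) ∂ν ∂P ≤ C := by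
    intro n
    rw [lintegral_lintegral_swap (hJm n).aemeasurable]
    have h1 : ∀ s, ∫⁻ ω, g n (Y (s, ω), ω) ∂P
        = (∫⁻ t, P {ω | |Y (t, ω) - Y (s, ω)| ≤ r n} ∂ν) / ENNReal.ofReal (2 * r n) := by
      intro s
      let D : Set (Ω × ℝ) := {q | |Y (q.2, q.1) - Y (s, q.1)| ≤ r n}
      have hD : MeasurableSet D := measurableSet_le
        (((hY.comp (by fun_prop)).sub (hY.comp (by fun_prop))).norm) measurable_const
      have h2 : ∀ ω, g n (Y (s, ω), ω) = ν (Prod.mk ω ⁻¹' D) / ENNReal.ofReal (2 * r n) :=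
        fun ω => rfl
      simp_rw [h2, div_eq_mul_inv]
      rw [lintegral_mul_const _ (measurable_measure_prodMk_left hD), ← Measure.prod_apply hD,
        Measure.prod_apply_symm hD]
      rfl
    simp_rw [h1, div_eq_mul_inv]
    rw [lintegral_mul_const', ← div_eq_mul_inv]
    · exact ENNReal.div_le_of_le_mul (h _ (hrpos n))
    · exact ENNReal.inv_ne_top.2 (by simpa using hrpos n)
  have hJ : ∫⁻ ω, liminf (fun n => ∫⁻ x, g n (x, ω) ∂(ρ ω)) atTop ∂P ≤ C := by
    simp_rw [hlint]
    refine (lintegral_liminf_le fun n => (hJm n).lintegral_prod_right').trans ?_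
    exact (liminf_le_liminf (.of_forall henergy)).trans (by simp)
  have hJfin : ∀ᵐ ω ∂P, liminf (fun n => ∫⁻ x, g n (x, ω) ∂(ρ ω)) atTop < ⊤ := by
    refine ae_lt_top ?_ (hJ.trans_lt (lt_top_iff_ne_top.2 hC)).ne
    simp_rw [hlint]
    exact Measurable.liminf fun n => (hJm n).lintegral_prod_right'
  have hmain : ∀ᵐ ω ∂P, ρ ω = volume.withDensity (fun x => liminf (fun n => g n (x, ω)) atTop) ∧
      ∫⁻ x, (liminf (fun n => g n (x, ω)) atTop) ^ 2
        ≤ liminf (fun n => ∫⁻ x, g n (x, ω) ∂(ρ ω)) atTop := by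
    filter_upwards [hJfin] with ω hω
    exact withDensity_liminf_of_energy (ρ ω) hr (fun n x => hg n ω x)
      (fun n => (hgm n).comp (by fun_prop)) hω.ne
  have hGm : Measurable fun q => liminf (fun n => g n q) atTop := Measurable.liminf hgm
  refine ⟨fun q => liminf (fun n => g n q) atTop, hGm, ?_, hmain.mono fun ω hω => hω.1⟩
  rw [lintegral_prod_symm _ (hGm.pow_const 2).aemeasurable]
  exact ((lintegral_mono_ae (hmain.mono fun ω hω => hω.2)).trans hJ).trans_lt
    (lt_top_iff_ne_top.2 hC)

end OccupationDensity

/-! ### From increments to the local time. -/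

section LocalTime

lemma lintegral_posPow_le {α T s : ℝ} (hα : -1 < α) (hs : s ∈ Icc 0 T) :
    ∫⁻ t in Icc 0 T, ENNReal.ofReal (posPow (t - s) α)
      ≤ ENNReal.ofReal (T ^ (α + 1) / (α + 1)) := by
  have hT : 0 ≤ T := hs.1.trans hs.2
  have hint := (intervalIntegrable_posPow hα s 0 T)
  rw [intervalIntegrable_iff_integrableOn_Icc_of_le hT] at hint
  rw [← ofReal_integral_eq_lintegral_ofReal hint (.of_forall fun t => posPow_nonneg _ _),
    integral_Icc_eq_integral_Ioc, ← intervalIntegral.integral_of_le hT,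
    integral_posPow hα hs.1 hs.2]
  refine ENNReal.ofReal_le_ofReal (div_le_div_of_nonneg_right ?_ (by linarith))
  exact Real.rpow_le_rpow (by linarith [hs.2]) (by linarith [hs.1]) (by linarith)

lemma lintegral_lintegral_posPow_le {α T : ℝ} (hα : -1 < α) :
    ∫⁻ s in Icc 0 T, ∫⁻ t in Icc 0 T, ENNReal.ofReal (posPow (t - s) α)
      ≤ ENNReal.ofReal (T ^ (α + 1) / (α + 1)) * ENNReal.ofReal T := by
  refine (setLIntegral_mono' measurableSet_Icc fun s hs => lintegral_posPow_le hα hs).trans ?_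
  rw [setLIntegral_const, Real.volume_Icc, sub_zero]

variable {Ω : Type*} [MeasurableSpace Ω] {P : Measure Ω} [IsProbabilityMeasure P]

/-- A process whose increments have characteristic functions that decay sufficiently fast has
occupation measures with a jointly measurable square integrable density. -/
theorem exists_density_of_norm_charFun_increment_le {T κ η : ℝ} (hκ : 0 < κ)
    (hη : η ∈ Ioo (0 : ℝ) 1) {X : ℝ → Ω → ℝ}
    (hX : ∀ s t, 0 ≤ s → s < t → t ≤ T → ∀ u : ℝ,
      ‖∫ ω, Complex.exp (((u * (X t ω - X s ω) : ℝ) : ℂ) * Complex.I) ∂P‖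
        ≤ (1 + 4 * u ^ 2 * (κ * (t - s) ^ η) ^ 2)⁻¹)
    {Y : ℝ × Ω → ℝ} (hY : Measurable Y)
    (hXY : ∀ᵐ t ∂(volume.restrict (Icc 0 T)), X t =ᵐ[P] fun ω => Y (t, ω))
    {A : Set ℝ} (hAT : A ⊆ Icc 0 T) :
    ∃ G : ℝ × Ω → ENNReal, Measurable G ∧ ∫⁻ q, G q ^ 2 ∂((volume : Measure ℝ).prod P) < ⊤ ∧
      ∀ᵐ ω ∂P, (volume.restrict A).map (fun s => Y (s, ω))
        = volume.withDensity fun x => G (x, ω) := by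
  have : IsFiniteMeasure (volume.restrict A) :=
    ⟨by simpa using (measure_mono hAT).trans_lt (by simp)⟩
  let k : ℝ → ℝ → ENNReal := fun s t => ENNReal.ofReal (posPow (t - s) (-η))
  have hkm : Measurable (Function.uncurry k) :=
    ((measurable_posPow (-η)).comp (by fun_prop)).ennreal_ofReal
  have hη1 : -1 < -η := by linarith [hη.2]
  set D : ENNReal := ENNReal.ofReal (T ^ (-η + 1) / (-η + 1)) * ENNReal.ofReal T
  have hYt : ∀ t, Measurable fun ω => Y (t, ω) := fun t => hY.comp (by fun_prop)
  have hsmall : ∀ r : ℝ, 0 < r → ∀ s t, 0 ≤ s → s < t → t ≤ T → X s =ᵐ[P] (fun ω => Y (s, ω)) →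
      X t =ᵐ[P] (fun ω => Y (t, ω)) → P {ω | |Y (t, ω) - Y (s, ω)| ≤ r}
        ≤ ENNReal.ofReal (2 * r) * (ENNReal.ofReal (2 / κ) * k s t) := by
    intro r hr s t hs hst ht hXs hXt
    have hd : 0 < t - s := sub_pos.2 hst
    have hdη := Real.rpow_pos_of_pos hd η
    refine (measure_abs_le_of_norm_charFun_le ((hYt t).sub (hYt s))
      (c := κ * (t - s) ^ η) (by positivity) (fun u => ?_) hr).trans (le_of_eq ?_)
    · refine le_trans (le_of_eq ?_) (hX s t hs hst ht u)
      congr 1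
      refine integral_congr_ae ?_
      filter_upwards [hXs, hXt] with ω h1 h2
      simp only [Pi.sub_apply, h1, h2]
    · simp only [k]
      rw [← ENNReal.ofReal_mul (by positivity), ← ENNReal.ofReal_mul (by positivity), posPow,
        if_pos hd, Real.rpow_neg hd.le]
      congr 1
      field_simp
      ring
  -- The small ball bound is `4r / (κ |t - s|^η) = 2r · (2/κ) · |t - s|^(-η)`; the two copies of `D`
  -- account for `s < t` and `t < s`.
  refine exists_density_of_energy_le hY (volume.restrict A)
    (C := ENNReal.ofReal (2 / κ) * (D + D)) (by finiteness) fun r hr => ?_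
  have hmono : ∫⁻ s in A, ∫⁻ t in A, P {ω | |Y (t, ω) - Y (s, ω)| ≤ r}
      ≤ ∫⁻ s in Icc 0 T, ∫⁻ t in Icc 0 T, P {ω | |Y (t, ω) - Y (s, ω)| ≤ r} :=
    (lintegral_mono_set hAT).trans (lintegral_mono fun s => lintegral_mono_set hAT)
  refine hmono.trans ?_
  calc _ ≤ ∫⁻ s in Icc 0 T, ∫⁻ t in Icc 0 T,
        ENNReal.ofReal (2 * r) * (ENNReal.ofReal (2 / κ) * (k s t + k t s)) := by
        refine lintegral_mono_ae ?_
        filter_upwards [hXY, ae_restrict_mem measurableSet_Icc] with s hXs hs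
        refine lintegral_mono_ae ?_
        filter_upwards [hXY, ae_restrict_mem measurableSet_Icc,
          ae_restrict_of_ae (compl_mem_ae_iff.2 (measure_singleton s))] with t hXt ht hts
        rcases lt_or_gt_of_ne (show t ≠ s from hts) with hlt | hlt
        · have := hsmall r hr t s ht.1 hlt hs.2 hXt hXs
          simp_rw [abs_sub_comm (Y (s, _))] at this
          refine this.trans ?_
          gcongr
          exact le_add_self
        · refine (hsmall r hr s t hs.1 hlt ht.2 hXs hXt).trans ?_
          gcongr
          exact le_self_add
    _ = ENNReal.ofReal (2 * r) * (ENNReal.ofReal (2 / κ) *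
          ((∫⁻ s in Icc 0 T, ∫⁻ t in Icc 0 T, k s t)
            + ∫⁻ s in Icc 0 T, ∫⁻ t in Icc 0 T, k t s)) := by
        have hk1 : Measurable fun s => ∫⁻ t in Icc 0 T, k s t := hkm.lintegral_prod_right'
        have hk2 : ∀ s, Measurable (k s) := fun s => hkm.of_uncurry_left
        rw [← lintegral_add_left hk1, ← lintegral_const_mul' _ _ ENNReal.ofReal_ne_top,
          ← lintegral_const_mul' _ _ ENNReal.ofReal_ne_top]
        refine lintegral_congr fun s => ?_
        rw [← lintegral_add_left (hk2 s), ← lintegral_const_mul' _ _ ENNReal.ofReal_ne_top,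
          ← lintegral_const_mul' _ _ ENNReal.ofReal_ne_top]
    _ ≤ _ := by
        rw [mul_comm (ENNReal.ofReal (2 * r))]
        gcongr
        · exact lintegral_lintegral_posPow_le hη1
        · rw [lintegral_lintegral_swap (f := fun s t => k t s)
            (hkm.comp measurable_swap).aemeasurable]
          exact lintegral_lintegral_posPow_le hη1

/-- A jointly measurable square integrable density of the occupation measures of a version of a
process is a square integrable local time of the process. -/
theorem exists_localTime_of_density {T : ℝ} {X : ℝ → Ω → ℝ} {Y : ℝ × Ω → ℝ} (hY : Measurable Y)
    (hXY : ∀ᵐ ω ∂P, ∀ᵐ s ∂(volume.restrict (Icc 0 T)), X s ω = Y (s, ω)) {A : Set ℝ}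
    (hAT : A ⊆ Icc 0 T) {G : ℝ × Ω → ENNReal} (hG : Measurable G)
    (hG2 : ∫⁻ q, G q ^ 2 ∂((volume : Measure ℝ).prod P) < ⊤)
    (hGY : ∀ᵐ ω ∂P, (volume.restrict A).map (fun s => Y (s, ω))
        = volume.withDensity fun x => G (x, ω)) :
    ∃ L : ℝ → Ω → ℝ, IsLocalTime P X A L ∧
      MemLp (fun q : ℝ × Ω => L q.1 q.2) 2 ((volume : Measure ℝ).prod P) := by
  -- Square integrability makes `G` finite almost everywhere, so passing to real values loses no
  -- mass.
  have hGfin : ∀ᵐ ω ∂P, ∀ᵐ x, G (x, ω) < ⊤ := by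
    rw [lintegral_prod_symm _ (hG.pow_const 2).aemeasurable] at hG2
    have h1 := ae_lt_top (hG.pow_const 2).lintegral_prod_left' hG2.ne
    filter_upwards [h1] with ω hω
    have hm : Measurable fun x => G (x, ω) ^ 2 := (hG.pow_const 2).comp (by fun_prop)
    filter_upwards [ae_lt_top hm hω.ne] with x hx
    exact lt_top_iff_ne_top.2 fun h => by simp [h] at hx
  have hL : Measurable fun q : ℝ × Ω => (G q).toReal := hG.ennreal_toReal
  refine ⟨fun x ω => (G (x, ω)).toReal, ⟨fun x ω => ENNReal.toReal_nonneg, ?_⟩,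
    hL.aestronglyMeasurable, ?_⟩
  · filter_upwards [hGfin, hGY, hXY] with ω hfin hω hXω
    refine ⟨(hL.comp (by fun_prop : Measurable fun x : ℝ => (x, ω))).aemeasurable, fun B hB => ?_⟩
    have hYω : Measurable fun s => Y (s, ω) := hY.comp (by fun_prop)
    have h1 : occupation X ω A B = (volume.restrict A).map (fun s => Y (s, ω)) B := by
      rw [Measure.map_apply hYω hB, Measure.restrict_apply (hYω hB), occupation]
      refine measure_congr ?_
      rw [ae_restrict_iff' measurableSet_Icc] at hXω
      filter_upwards [hXω] with s hs
      refine propext ⟨fun h => ⟨?_, h.1⟩, fun h => ⟨h.2, ?_⟩⟩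
      · have := h.2
        rw [hs (hAT h.1)] at this
        exact this
      · rw [hs (hAT h.2)]
        exact h.1
    rw [h1, hω, withDensity_apply _ hB]
    refine lintegral_congr_ae (ae_restrict_of_ae ?_)
    filter_upwards [hfin] with x hx
    exact (ENNReal.ofReal_toReal hx.ne).symm
  · rw [eLpNorm_lt_top_iff_lintegral_rpow_enorm_lt_top (by norm_num) (by norm_num)]
    refine lt_of_le_of_lt (lintegral_mono fun q => ?_) hG2
    rw [Real.enorm_of_nonneg ENNReal.toReal_nonneg]
    simp only [ENNReal.toReal_ofNat, ENNReal.rpow_ofNat]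
    gcongr
    exact ENNReal.ofReal_toReal_le

end LocalTime

end Rosenblatt

theorem mainTheorem3 {Ω : Type*} [MeasurableSpace Ω] (P : Measure Ω) [IsProbabilityMeasure P]
    (W : Set ℝ → Ω → ℝ) (hW : Rosenblatt.IsWienerMeasure P W)
    (T : ℝ) (hT : 0 < T) (H₁ H₂ : ℝ → ℝ)
    (hH₁ : ∀ t ∈ Icc 0 T, H₁ t ∈ Ioo (1 / 2 : ℝ) 1)
    (hH₂ : ∀ t ∈ Icc 0 T, H₂ t ∈ Ioo (1 / 2 : ℝ) 1)
    (hcont₁ : ContinuousOn H₁ (Icc 0 T)) (hcont₂ : ContinuousOn H₂ (Icc 0 T))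
    (γ : ℝ) (hγ : (sSup (H₁ '' Icc 0 T) + sSup (H₂ '' Icc 0 T)) / 2 < γ)
    (hHolder₁ : ∀ s ∈ Icc 0 T, ∀ t ∈ Icc 0 T, |H₁ t - H₁ s| ≤ |t - s| ^ γ)
    (hHolder₂ : ∀ s ∈ Icc 0 T, ∀ t ∈ Icc 0 T, |H₂ t - H₂ s| ≤ |t - s| ^ γ)
    (X : ℝ → Ω → ℝ) (hX : Rosenblatt.IsMultifractionalRosenblatt P W T H₁ H₂ X) :
    Rosenblatt.HasSquareIntegrableLocalTime P T X := by
  intro A _ hAT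
  obtain ⟨κ, hκ, η, hη, hchar⟩ := Rosenblatt.exists_norm_charFun_increment_le hW hT hH₁ hH₂ hcont₁
    hcont₂ hX.isDoubleIntegral
  have hXY := hX.aemeasurable.ae_eq_mk
  have hY := hX.aemeasurable.measurable_mk
  -- Fubini is used in both orders: equality almost surely for almost every `t` transfers the law of
  -- increments, and equality for almost every `s` along almost every path transfers occupation
  -- measures.
  have hXY' := (Measure.measurePreserving_swap (μ := P)
    (ν := volume.restrict (Icc 0 T))).quasiMeasurePreserving.ae hXY
  obtain ⟨G, hG, hG2, hGY⟩ := Rosenblatt.exists_density_of_norm_charFun_increment_le hκ hη hchar hY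
    (Measure.ae_ae_of_ae_prod hXY) hAT
  exact Rosenblatt.exists_localTime_of_density hY (Measure.ae_ae_of_ae_prod hXY') hAT hG hG2 hGY
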